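/- Let $n\ge 1$, let $M$ be a connected smooth manifold of dimension $2n+1$ with a smooth Riemannian metric $g$ and Levi-Civita connection $\nabla$, and put $R_{X,Y}Z=\nabla_X\nabla_YZ-\nabla_Y\nabla_XZ-\nabla_{[X,Y]}Z$, $\operatorname{Ric}(X,Y)=\operatorname{trace}\{Z\mapsto R_{Z,X}Y\}$, $r=\operatorname{trace}_g\operatorname{Ric}$. Let $(f,Q,\xi,\eta,g)$ be a weak almost contact metric structure on $M$: $f$ is a smooth $(1,1)$-tensor of rank $2n$, $Q$ is a smooth nonsingular $(1,1)$-tensor, $\xi$ is a smooth vector field and $\eta$ is a smooth 1-form such that $$f^2=-Q+\eta\otimes\xi,\quad \eta(\xi)=1,\quad Q\xi=\xi,\quad g(fX,fY)=g(X,QY)-\eta(X)\eta(Y),$$ and $\ker\eta$ is $f$-invariant. Assume that it is weak $\beta$-Kenmotsu for a real constant $\beta\neq0$, that is, $$(\nabla_Xf)Y=\beta\{g(fX,Y)\,\xi-\eta(Y)\,fX\}$$ for all vector fields $X,Y$. Define the $\ast$-Ricci tensor by $\operatorname{Ric}^\ast(X,Y)=\tfrac12\operatorname{trace}\{Z\mapsto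 R_{X,fY}fZ\}$. Let $\delta$ be a smooth function on $M$ that is not identically zero (for example, nowhere zero), and suppose that $V=\delta\,\xi$ is the potential vector field of a $\ast$-$\eta$-Ricci soliton, that is, for some real constants $\lambda,\mu$, $$\tfrac12\,\pounds_Vg+\operatorname{Ric}^\ast=\lambda\,g+\mu\,\eta\otimes\eta .$$ Then $\delta$ is constant and $(M,g)$ is an Einstein manifold ($\operatorname{Ric}=c\,g$ for a real constant $c$) of scalar curvature $r=-2n(2n+1)\beta^2$. Moreover, $M$ is $\ast$-$\eta$-Einstein: $\operatorname{Ric}^\ast=a\,g+b\,\eta\otimes\eta$ for some smooth functions $a,b$ on $M$. -/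

import Mathlib

open Bundle VectorField FiberBundle
open scoped Manifold ContDiff

namespace WeakKenmotsu

section LeviCivita

variable {E : Type*} [NormedAddCommGroup E] [NormedSpace ℝ E] [FiniteDimensional ℝ E]
  {H : Type*} [TopologicalSpace H] (I : ModelWithCorners ℝ E H)
  {M : Type*} [TopologicalSpace M] [ChartedSpace H M] [IsManifold I ∞ M]
  [RiemannianBundle (fun p : M ↦ TangentSpace I p)]
  [IsContMDiffRiemannianBundle I ∞ E (fun p : M ↦ TangentSpace I p)]

/-- The right-hand side of the Koszul formula for `2 g(∇_X Y, Z)`. -/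
noncomputable def koszul (X Y Z : Π p : M, TangentSpace I p) (p : M) : ℝ :=
  mvfderiv I (fun q ↦ inner ℝ (Y q) (Z q)) p (X p)
    + mvfderiv I (fun q ↦ inner ℝ (X q) (Z q)) p (Y p)
    - mvfderiv I (fun q ↦ inner ℝ (X q) (Y q)) p (Z p)
    + inner ℝ (mlieBracket I X Y p) (Z p)
    - inner ℝ (mlieBracket I X Z p) (Y p)
    - inner ℝ (mlieBracket I Y Z p) (X p)

theorem mdifferentiableAt_inner {X Y : Π p : M, TangentSpace I p} {p : M}
    (hX : MDiffAt (T% X) p) (hY : MDiffAt (T% Y) p) :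
    MDiffAt (fun q ↦ inner ℝ (X q) (Y q)) p :=
  MDifferentiableAt.inner_bundle (IB := I) (F := E) (E := fun p : M ↦ TangentSpace I p) hX hY

theorem tensorialAt_koszul_left {Y Z : Π p : M, TangentSpace I p} {p : M}
    (hY : MDiffAt (T% Y) p) (hZ : MDiffAt (T% Z) p) :
    TensorialAt I E (fun X ↦ koszul I X Y Z p) p where
  smul {f X} hf hX := by
    have : CompleteSpace E := FiniteDimensional.complete ℝ E
    have : IsManifold I 2 M := IsManifold.of_le (n := ∞) (by decide)
    simp [koszul, mvfderiv_fun_mul hf (mdifferentiableAt_inner I hX hZ),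
      mvfderiv_fun_mul hf (mdifferentiableAt_inner I hX hY),
      mlieBracket_smul_left hf hX, inner_add_left, inner_smul_left, inner_smul_right]
    ring
  add {X X'} hX hX' := by
    have : CompleteSpace E := FiniteDimensional.complete ℝ E
    have : IsManifold I 2 M := IsManifold.of_le (n := ∞) (by decide)
    simp [koszul, mvfderiv_fun_add (mdifferentiableAt_inner I hX hZ) (mdifferentiableAt_inner I hX' hZ),
      mvfderiv_fun_add (mdifferentiableAt_inner I hX hY) (mdifferentiableAt_inner I hX' hY),
      mlieBracket_add_left hX hX', inner_add_left, inner_add_right]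
    ring

theorem tensorialAt_koszul_right {X Y : Π p : M, TangentSpace I p} {p : M}
    (hX : MDiffAt (T% X) p) (hY : MDiffAt (T% Y) p)  :
    TensorialAt I E (fun Z ↦ koszul I X Y Z p) p where
  smul {f Z} hf hZ := by
    have : CompleteSpace E := FiniteDimensional.complete ℝ E
    have : IsManifold I 2 M := IsManifold.of_le (n := ∞) (by decide)
    simp [koszul, mvfderiv_fun_mul hf (mdifferentiableAt_inner I hX hZ),
      mvfderiv_fun_mul hf (mdifferentiableAt_inner I hY hZ),
      mlieBracket_smul_right hf hZ, inner_add_left, inner_smul_left, inner_smul_right]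
    rw [real_inner_comm (Y p) (Z p), real_inner_comm (X p) (Z p)]
    ring
  add {Z Z'} hZ hZ' := by
    have : CompleteSpace E := FiniteDimensional.complete ℝ E
    have : IsManifold I 2 M := IsManifold.of_le (n := ∞) (by decide)
    simp [koszul, mvfderiv_fun_add (mdifferentiableAt_inner I hX hZ) (mdifferentiableAt_inner I hX hZ'),
      mvfderiv_fun_add (mdifferentiableAt_inner I hY hZ) (mdifferentiableAt_inner I hY hZ'),
      mlieBracket_add_right hZ hZ', inner_add_left, inner_add_right]
    ring

open scoped Classical in
/-- `leviCivitaFun I Y p v` is `∇_v Y` at `p`: the vector `w` with `2 g(w, Z) = koszul X Y Z` for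
all vector fields `X`, `Z` with `X p = v` (and zero if `Y` is not differentiable at `p`). -/
noncomputable def leviCivitaFun (Y : Π p : M, TangentSpace I p) (p : M) :
    TangentSpace I p →L[ℝ] TangentSpace I p :=
  haveI : FiniteDimensional ℝ (TangentSpace I p) := inferInstanceAs (FiniteDimensional ℝ E)
  haveI : CompleteSpace (TangentSpace I p) := FiniteDimensional.complete ℝ _
  if hY : MDiffAt (T% Y) p then
    let B := TensorialAt.mkHom₂ (fun X Z ↦ koszul I X Y Z p) p
      (fun _ hZ ↦ tensorialAt_koszul_left I hY hZ) (fun _ hX ↦ tensorialAt_koszul_right I hX hY)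
    LinearMap.toContinuousLinearMap
      { toFun v := (InnerProductSpace.toDual ℝ (TangentSpace I p)).symm ((1 / 2 : ℝ) • B v)
        map_add' v w := by simp
        map_smul' c v := by
          simp only [map_smul, RingHom.id_apply]
          module }
  else 0

theorem inner_leviCivitaFun {X Y Z : Π p : M, TangentSpace I p} {p : M}
    (hX : MDiffAt (T% X) p) (hY : MDiffAt (T% Y) p) (hZ : MDiffAt (T% Z) p) :
    inner ℝ (leviCivitaFun I Y p (X p)) (Z p) = 1 / 2 * koszul I X Y Z p := by
  rw [leviCivitaFun, dif_pos hY]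
  have h := TensorialAt.mkHom₂_apply (Φ := fun X Z ↦ koszul I X Y Z p)
    (fun _ hZ ↦ tensorialAt_koszul_left I hY hZ)
    (fun _ hX ↦ tensorialAt_koszul_right I hX hY) hX hZ
  simp [inner_smul_left, h]

theorem leviCivitaFun_ext {p : M} {A B : TangentSpace I p →L[ℝ] TangentSpace I p}
    (h : ∀ X Z : Π p : M, TangentSpace I p, MDiffAt (T% X) p → MDiffAt (T% Z) p →
      inner ℝ (A (X p)) (Z p) = inner ℝ (B (X p)) (Z p)) : A = B := by
  ext v
  refine ext_inner_right ℝ fun w ↦ ?_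
  simpa using h (extend E v) (extend E w) (mdifferentiableAt_extend ..)
    (mdifferentiableAt_extend ..)

variable (M) in
/-- The Levi-Civita connection of the metric. -/
noncomputable def leviCivita : CovariantDerivative I E (fun p : M ↦ TangentSpace I p) where
  toFun := leviCivitaFun I
  isCovariantDerivativeOnUniv :=
    { add := by
        intro Y Y' p hY hY' _
        have : CompleteSpace E := FiniteDimensional.complete ℝ E
        have : IsManifold I 2 M := IsManifold.of_le (n := ∞) (by decide)
        refine leviCivitaFun_ext I fun X Z hX hZ ↦ ?_
        rw [add_apply, inner_add_left,
          inner_leviCivitaFun I hX (mdifferentiableAt_add_section hY hY') hZ,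
          inner_leviCivitaFun I hX hY hZ, inner_leviCivitaFun I hX hY' hZ]
        simp [koszul, mvfderiv_fun_add (mdifferentiableAt_inner I hY hZ) (mdifferentiableAt_inner I hY' hZ),
          mvfderiv_fun_add (mdifferentiableAt_inner I hX hY) (mdifferentiableAt_inner I hX hY'),
          mlieBracket_add_left hY hY', mlieBracket_add_right hY hY', inner_add_left,
          inner_add_right]
        ring
      leibniz := by
        intro Y f p hY hf _
        have : CompleteSpace E := FiniteDimensional.complete ℝ E
        have : IsManifold I 2 M := IsManifold.of_le (n := ∞) (by decide)
        refine leviCivitaFun_ext I fun X Z hX hZ ↦ ?_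
        rw [add_apply, inner_add_left,
          inner_leviCivitaFun I hX (hf.smul_section hY) hZ, smul_apply,
          inner_smul_left, inner_leviCivitaFun I hX hY hZ]
        simp [koszul, mvfderiv_fun_mul hf (mdifferentiableAt_inner I hX hY),
          mvfderiv_fun_mul hf (mdifferentiableAt_inner I hY hZ),
          mlieBracket_smul_left hf hY, mlieBracket_smul_right hf hY, inner_add_left,
          inner_smul_left, inner_smul_right]
        rw [real_inner_comm (X p) (Y p)]
        ring }

/-- The Levi-Civita connection is torsion-free. -/
theorem leviCivita_torsion_free {X Y : Π p : M, TangentSpace I p} {p : M}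
    (hX : MDiffAt (T% X) p) (hY : MDiffAt (T% Y) p) :
    leviCivita I M Y p (X p) - leviCivita I M X p (Y p) = mlieBracket I X Y p := by
  refine ext_inner_right ℝ fun w ↦ ?_
  have hZ : MDiffAt (T% (extend E w : Π p : M, TangentSpace I p)) p := mdifferentiableAt_extend ..
  have h1 := inner_leviCivitaFun I hX hY hZ
  have h2 := inner_leviCivitaFun I hY hX hZ
  have h3 : mlieBracket I Y X p = -mlieBracket I X Y p := mlieBracket_swap_apply
  have h4 : (fun q ↦ inner ℝ (Y q) (X q) : M → ℝ) = fun q ↦ inner ℝ (X q) (Y q) :=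
    funext fun q ↦ real_inner_comm _ _
  simp only [extend_apply_self, koszul, h3, h4, inner_neg_left] at h1 h2
  rw [inner_sub_left]
  change inner ℝ (leviCivitaFun I Y p (X p)) w - inner ℝ (leviCivitaFun I X p (Y p)) w = _
  rw [h1, h2]
  ring

/-- The Levi-Civita connection is compatible with the metric. -/
theorem leviCivita_metric {X Y Z : Π p : M, TangentSpace I p} {p : M}
    (hX : MDiffAt (T% X) p) (hY : MDiffAt (T% Y) p) (hZ : MDiffAt (T% Z) p) :
    mvfderiv I (fun q ↦ inner ℝ (Y q) (Z q)) p (X p) =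
      inner ℝ (leviCivita I M Y p (X p)) (Z p) + inner ℝ (Y p) (leviCivita I M Z p (X p)) := by
  have h1 := inner_leviCivitaFun I hX hY hZ
  have h2 := inner_leviCivitaFun I hX hZ hY
  have h3 : mlieBracket I Z Y p = -mlieBracket I Y Z p := mlieBracket_swap_apply
  have h4 : (fun q ↦ inner ℝ (Z q) (Y q) : M → ℝ) = fun q ↦ inner ℝ (Y q) (Z q) :=
    funext fun q ↦ real_inner_comm _ _
  simp only [koszul, h3, h4, inner_neg_left] at h1 h2
  rw [real_inner_comm _ (Y p)]
  change _ = inner ℝ (leviCivitaFun I Y p (X p)) (Z p) + inner ℝ (leviCivitaFun I Z p (X p)) (Y p)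
  rw [h1, h2]
  ring

end LeviCivita

section Curvature

variable {E : Type*} [NormedAddCommGroup E] [NormedSpace ℝ E] [FiniteDimensional ℝ E]
  {H : Type*} [TopologicalSpace H] (I : ModelWithCorners ℝ E H)
  {M : Type*} [TopologicalSpace M] [ChartedSpace H M] [IsManifold I ∞ M]
  [RiemannianBundle (fun p : M ↦ TangentSpace I p)]
  [IsContMDiffRiemannianBundle I ∞ E (fun p : M ↦ TangentSpace I p)]

instance (p : M) : FiniteDimensional ℝ (TangentSpace I p) :=
  inferInstanceAs (FiniteDimensional ℝ E)

/-- The curvature `R_{X,Y} Z = ∇_X ∇_Y Z - ∇_Y ∇_X Z - ∇_{[X,Y]} Z`. -/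
noncomputable def curvature (X Y Z : Π p : M, TangentSpace I p) (p : M) : TangentSpace I p :=
  leviCivita I M (fun q ↦ leviCivita I M Z q (Y q)) p (X p)
    - leviCivita I M (fun q ↦ leviCivita I M Z q (X q)) p (Y p)
    - leviCivita I M Z p (mlieBracket I X Y p)

/-- The curvature tensor at a point: `R_{u,v} w` is computed with extensions of the vectors
`u`, `v`, `w` to vector fields that are smooth near `p`. -/
noncomputable def curvatureAt (p : M) (u v w : TangentSpace I p) : TangentSpace I p :=
  curvature I (extend E u) (extend E v) (extend E w) p

/-- The Ricci tensor `Ric(u, v) = trace (Z ↦ R_{Z,u} v)`, the trace being computed in an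
orthonormal basis. -/
noncomputable def ricci (p : M) (u v : TangentSpace I p) : ℝ :=
  ∑ i, inner ℝ (curvatureAt I p (stdOrthonormalBasis ℝ (TangentSpace I p) i) u v)
    (stdOrthonormalBasis ℝ (TangentSpace I p) i)

/-- The scalar curvature, the trace of the Ricci tensor with respect to the metric. -/
noncomputable def scalarCurvature (p : M) : ℝ :=
  ∑ i, ricci I p (stdOrthonormalBasis ℝ (TangentSpace I p) i)
    (stdOrthonormalBasis ℝ (TangentSpace I p) i)

variable (M) in
/-- The metric is Einstein: `Ric = c g` for a real constant `c`. -/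
def IsEinstein : Prop :=
  ∃ c : ℝ, ∀ (p : M) (u v : TangentSpace I p), ricci I p u v = c * inner ℝ u v

/-- The Lie derivative of the metric,
`(£_V g)(X, Y) = V (g(X, Y)) - g([V, X], Y) - g(X, [V, Y])`. -/
noncomputable def lieDerivMetric (V X Y : Π p : M, TangentSpace I p) (p : M) : ℝ :=
  mvfderiv I (fun q ↦ inner ℝ (X q) (Y q)) p (V p)
    - inner ℝ (mlieBracket I V X p) (Y p) - inner ℝ (X p) (mlieBracket I V Y p)

/-- The covariant derivative of a (1,1)-tensor field, `(∇_X f) Y = ∇_X (f Y) - f (∇_X Y)`. -/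
noncomputable def covDerivEnd (f : Π p : M, TangentSpace I p →L[ℝ] TangentSpace I p)
    (X Y : Π p : M, TangentSpace I p) (p : M) : TangentSpace I p :=
  leviCivita I M (fun q ↦ f q (Y q)) p (X p) - f p (leviCivita I M Y p (X p))

end Curvature

section WeakStructures

variable {E : Type*} [NormedAddCommGroup E] [NormedSpace ℝ E] [FiniteDimensional ℝ E]
  {H : Type*} [TopologicalSpace H] (I : ModelWithCorners ℝ E H)
  (M : Type*) [TopologicalSpace M] [ChartedSpace H M] [IsManifold I ∞ M]
  [RiemannianBundle (fun p : M ↦ TangentSpace I p)]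

/-- A weak almost contact metric structure `(f, Q, ξ, η)` on a Riemannian manifold `M` (of
dimension `2n+1`); the distribution `ker η` is `f`-invariant. -/
structure WeakAlmostContactMetric (n : ℕ) where
  f : Π p : M, TangentSpace I p →L[ℝ] TangentSpace I p
  Q : Π p : M, TangentSpace I p →L[ℝ] TangentSpace I p
  ξ : Π p : M, TangentSpace I p
  η : Π p : M, TangentSpace I p →L[ℝ] ℝ
  contMDiff_f : ContMDiff I (I.prod 𝓘(ℝ, E →L[ℝ] E)) ∞
    (fun p ↦ TotalSpace.mk' (E →L[ℝ] E)
      (E := fun p : M ↦ TangentSpace I p →L[ℝ] TangentSpace I p) p (f p))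
  contMDiff_Q : ContMDiff I (I.prod 𝓘(ℝ, E →L[ℝ] E)) ∞
    (fun p ↦ TotalSpace.mk' (E →L[ℝ] E)
      (E := fun p : M ↦ TangentSpace I p →L[ℝ] TangentSpace I p) p (Q p))
  contMDiff_ξ : CMDiff ∞ (T% ξ)
  contMDiff_η : ContMDiff I (I.prod 𝓘(ℝ, E →L[ℝ] ℝ)) ∞
    (fun p ↦ TotalSpace.mk' (E →L[ℝ] ℝ)
      (E := fun p : M ↦ TangentSpace I p →L[ℝ] ℝ) p (η p))
  rank_f : ∀ p, Module.finrank ℝ (LinearMap.range (f p).toLinearMap) = 2 * n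
  bijective_Q : ∀ p, Function.Bijective (Q p)
  f_sq : ∀ p v, f p (f p v) = -Q p v + η p v • ξ p
  η_ξ : ∀ p, η p (ξ p) = 1
  Q_ξ : ∀ p, Q p (ξ p) = ξ p
  inner_f_f : ∀ p (u v : TangentSpace I p),
    inner ℝ (f p u) (f p v) = inner ℝ u (Q p v) - η p u * η p v
  η_f : ∀ p v, η p v = 0 → η p (f p v) = 0

namespace WeakAlmostContactMetric

variable {I M} [IsContMDiffRiemannianBundle I ∞ E (fun p : M ↦ TangentSpace I p)] {n : ℕ}
  (S : WeakAlmostContactMetric I M n)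

/-- A weak `β`-Kenmotsu structure: `(∇_X f) Y = β {g(f X, Y) ξ - η(Y) f X}` with a nowhere zero
smooth function `β`, and `dβ ∧ η = 0` if `n = 1`. -/
structure IsWeakKenmotsu (β : M → ℝ) : Prop where
  contMDiff : ContMDiff I 𝓘(ℝ) ∞ β
  ne_zero : ∀ p, β p ≠ 0
  covDeriv_f : ∀ X Y : Π p : M, TangentSpace I p, CMDiff ∞ (T% X) → CMDiff ∞ (T% Y) → ∀ p,
    covDerivEnd I S.f X Y p =
      β p • ((inner ℝ (S.f p (X p)) (Y p) : ℝ) • S.ξ p - S.η p (Y p) • S.f p (X p))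
  wedge : n = 1 → ∀ (p : M) (u v : TangentSpace I p),
    mvfderiv I β p u * S.η p v - mvfderiv I β p v * S.η p u = 0

/-- The `∗`-Ricci tensor `Ric∗(u, v) = (1/2) trace (Z ↦ R_{u, f v} (f Z))`, the trace being
computed in an orthonormal basis. -/
noncomputable def starRicci (p : M) (u v : TangentSpace I p) : ℝ :=
  1 / 2 * ∑ i,
    inner ℝ (curvatureAt I p u (S.f p v)
        (S.f p (stdOrthonormalBasis ℝ (TangentSpace I p) i)))
      (stdOrthonormalBasis ℝ (TangentSpace I p) i)

/-- The structure is `∗`-`η`-Einstein: `Ric∗ = a g + b η ⊗ η` for smooth functions `a`, `b`. -/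
def IsStarEtaEinstein : Prop :=
  ∃ a b : M → ℝ, ContMDiff I 𝓘(ℝ) ∞ a ∧ ContMDiff I 𝓘(ℝ) ∞ b ∧
    ∀ (p : M) (u v : TangentSpace I p),
      S.starRicci p u v = a p * inner ℝ u v + b p * (S.η p u * S.η p v)

/-- The `∗`-`η`-Ricci soliton equation `(1/2) £_V g + Ric∗ = lam g + mu η ⊗ η` for a smooth vector
field `V` and real constants `lam`, `mu`. -/
def IsStarEtaRicciSoliton (V : Π p : M, TangentSpace I p) (lam mu : ℝ) : Prop :=
  CMDiff ∞ (T% V) ∧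
    ∀ X Y : Π p : M, TangentSpace I p, CMDiff ∞ (T% X) → CMDiff ∞ (T% Y) → ∀ p,
      1 / 2 * lieDerivMetric I V X Y p + S.starRicci p (X p) (Y p) =
        lam * inner ℝ (X p) (Y p) + mu * (S.η p (X p) * S.η p (Y p))

end WeakAlmostContactMetric

end WeakStructures

end WeakKenmotsu

/-!
The curvature of a weak `β`-Kenmotsu manifold is compared with that of hyperbolic space of curvature
`-β²`. Put `(X ∧ Y) Z = g(Y, Z) X - g(X, Z) Y` and `K = R + β² ∧`. From `∇ξ = β (id - η ⊗ ξ)` and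
the equation for `∇f` one finds that `K` vanishes as soon as one argument is `ξ`
(`KenmotsuAlgebra.K_ξ_right`, `KenmotsuAlgebra.K_ξ_left`), that the operators `K_{X,Y}` commute with
`f` (`KenmotsuAlgebra.K_f`), and, by the second Bianchi identity, that `∇_ξ K = -2 β K`
(`KenmotsuAlgebra.nab_ξ_K'`). These are identities over the ring of smooth functions, and they are
proved for an abstract module with a metric and a Levi-Civita connection.

Let `ρ(u, v) = trace (z ↦ K_{z,u} v)`. Then `Ric = ρ - 2 n β² g`, and the first Bianchi identity
gives `Ric∗(u, v) = -ρ(u, f² v) - β² g(f u, f v)` (`ricci_eq`, `starRicci_eq`). Also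
`∇_ξ ρ = -2 β ρ` (`mvfderiv_ρ`).

For a soliton with potential `δ ξ`, one has `Ric∗(·, ξ) = 0` and
`£_{δξ} g = dδ ⊗ η + η ⊗ dδ + 2 δ β (g - η ⊗ η)`. Hence `dδ = κ η` with `κ = lam + mu`, and
`Ric∗ = σ (g - η ⊗ η)` with `σ = lam - δ β`. So `ρ(X, f² Y)` is equal to
`H(X, Y) = -(β² g(f X, f Y) + σ (g - η ⊗ η)(X, Y))`. The tensors `f`, `g` and `η` are parallel along
`ξ` and `dσ(ξ) = -β κ`; thus `∇_ξ H = β κ (g - η ⊗ η)`, whereas the law for `ρ` gives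
`∇_ξ H = -2 β H`. Therefore `κ (g - η ⊗ η) = -2 H`, and a further derivative along `ξ` shows that
`κ = 0`, because `g - η ⊗ η` is not zero for `n ≥ 1` (`lam_add_mu_eq_zero`). Consequently `δ` is
constant and `H = 0`. As `Q = -f² + η ⊗ ξ` is surjective, `ρ = 0` (`ρ_eq_zero_of_soliton`), which is
the Einstein condition.
-/

namespace WeakKenmotsu

open scoped Topology

/-! ### Curvature of a Levi-Civita connection over the module of vector fields -/

/-- The algebraic shadow of a Riemannian manifold with its Levi-Civita connection. `A` stands for
the ring of smooth functions and `Γ` for the `A`-module of smooth vector fields; `D X` is the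
derivative along `X`, `br` the Lie bracket, `g` the metric and `nab X Y = ∇_X Y`. The maps `D` and
`nab` are `A`-linear in `X` and additive in their second argument; the Leibniz rules are separate
fields. Bilinearity properties of the bracket follow from `torsion`. -/
structure LeviCivitaAlgebra (A Γ : Type*) [CommRing A] [Algebra ℝ A] [AddCommGroup Γ]
    [Module A Γ] where
  D : Γ →ₗ[A] A →+ A
  br : Γ → Γ → Γ
  g : Γ →ₗ[A] Γ →ₗ[A] A
  nab : Γ →ₗ[A] Γ →+ Γ
  D_mul : ∀ X a b, D X (a * b) = a * D X b + b * D X a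
  D_br : ∀ X Y a, D (br X Y) a = D X (D Y a) - D Y (D X a)
  jacobi : ∀ X Y Z, br X (br Y Z) = br (br X Y) Z + br Y (br X Z)
  nab_smul : ∀ X a Y, nab X (a • Y) = D X a • Y + a • nab X Y
  torsion : ∀ X Y, nab X Y - nab Y X = br X Y
  metric : ∀ X Y Z, D X (g Y Z) = g (nab X Y) Z + g Y (nab X Z)
  g_symm : ∀ X Y, g X Y = g Y X
  g_nondeg : ∀ X, (∀ Z, g X Z = 0) → X = 0

namespace LeviCivitaAlgebra

variable {A Γ : Type*} [CommRing A] [Algebra ℝ A] [AddCommGroup Γ] [Module A Γ]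
  (C : LeviCivitaAlgebra A Γ)

theorem br_eq (X Y : Γ) : C.br X Y = C.nab X Y - C.nab Y X := (C.torsion X Y).symm

theorem br_swap (X Y : Γ) : C.br X Y = -C.br Y X := by
  rw [br_eq, br_eq, neg_sub]

theorem br_add_left (X Y Z : Γ) : C.br (X + Y) Z = C.br X Z + C.br Y Z := by
  simp only [br_eq, map_add, AddMonoidHom.add_apply]; abel

theorem br_add_right (X Y Z : Γ) : C.br X (Y + Z) = C.br X Y + C.br X Z := by
  simp only [br_eq, map_add, AddMonoidHom.add_apply]; abel

theorem br_smul_right (a : A) (X Y : Γ) : C.br X (a • Y) = C.D X a • Y + a • C.br X Y := by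
  simp only [br_eq, map_smul, C.nab_smul, AddMonoidHom.smul_apply]; module

theorem br_smul_left (a : A) (X Y : Γ) : C.br (a • X) Y = a • C.br X Y - C.D Y a • X := by
  rw [br_swap, br_smul_right, C.br_swap Y X]; module

/-- The curvature `R_{X,Y} Z` of the connection, as a trilinear map. -/
def curv : Γ →ₗ[A] Γ →ₗ[A] Γ →ₗ[A] Γ :=
  LinearMap.mk₂ A
    (fun X Y ↦
      { toFun Z := C.nab X (C.nab Y Z) - C.nab Y (C.nab X Z) - C.nab (C.br X Y) Z
        map_add' Z W := by simp only [map_add]; abel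
        map_smul' a Z := by
          simp only [C.nab_smul, map_add, C.D_br, RingHom.id_apply]; module })
    (fun X X' Y ↦ by
      ext Z
      simp only [LinearMap.coe_mk, AddHom.coe_mk, LinearMap.add_apply, br_add_left, map_add,
        AddMonoidHom.add_apply]
      abel)
    (fun a X Y ↦ by
      ext Z
      simp only [LinearMap.coe_mk, AddHom.coe_mk, LinearMap.smul_apply, br_smul_left, map_sub,
        map_smul, AddMonoidHom.sub_apply, AddMonoidHom.smul_apply, C.nab_smul]
      module)
    (fun X Y Y' ↦ by
      ext Z
      simp only [LinearMap.coe_mk, AddHom.coe_mk, LinearMap.add_apply, br_add_right, map_add,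
        AddMonoidHom.add_apply]
      abel)
    (fun a X Y ↦ by
      ext Z
      simp only [LinearMap.coe_mk, AddHom.coe_mk, LinearMap.smul_apply, br_smul_right, map_add,
        map_smul, AddMonoidHom.add_apply, AddMonoidHom.smul_apply, C.nab_smul]
      module)

theorem curv_apply (X Y Z : Γ) :
    C.curv X Y Z = C.nab X (C.nab Y Z) - C.nab Y (C.nab X Z) - C.nab (C.br X Y) Z := rfl

theorem curv_swap (X Y Z : Γ) : C.curv X Y Z = -C.curv Y X Z := by
  simp only [curv_apply, C.br_swap Y X, map_neg, AddMonoidHom.neg_apply]; abel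

theorem curv_bianchi (X Y Z : Γ) : C.curv X Y Z + C.curv Y Z X + C.curv Z X Y = 0 := by
  have h1 := C.jacobi X Y Z
  rw [C.br_swap (C.br X Y) Z, C.br_swap X Z, C.br_eq X (C.br Y Z), C.br_eq Z (C.br X Y)] at h1
  have h2 : C.br Y (-C.br Z X) =
      -C.nab Y (C.nab Z X) + C.nab Y (C.nab X Z) + C.nab (C.br Z X) Y := by
    simp only [C.br_eq, map_neg, map_sub, AddMonoidHom.neg_apply, AddMonoidHom.sub_apply]
    abel
  rw [h2] at h1
  have h3 : C.nab X (C.br Y Z) = C.nab X (C.nab Y Z) - C.nab X (C.nab Z Y) := by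
    rw [C.br_eq Y Z, map_sub]
  have h4 : C.nab Z (C.br X Y) = C.nab Z (C.nab X Y) - C.nab Z (C.nab Y X) := by
    rw [C.br_eq X Y, map_sub]
  rw [h3, h4] at h1
  simp only [curv_apply]
  linear_combination (norm := module) h1

theorem g_curv_skew (X Y Z W : Γ) : C.g (C.curv X Y Z) W = -C.g (C.curv X Y W) Z := by
  have h := C.D_br X Y (C.g Z W)
  simp only [C.metric, map_add] at h
  rw [C.g_symm _ Z]
  simp only [curv_apply, map_sub, LinearMap.sub_apply]
  linear_combination -h

/-- The second Bianchi identity, for the curvature operators acting on sections. -/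
theorem curv_second_bianchi (X Y Z W : Γ) :
    C.nab X (C.curv Y Z W) - C.curv Y Z (C.nab X W) + C.curv X (C.br Y Z) W
      + (C.nab Y (C.curv Z X W) - C.curv Z X (C.nab Y W) + C.curv Y (C.br Z X) W)
      + (C.nab Z (C.curv X Y W) - C.curv X Y (C.nab Z W) + C.curv Z (C.br X Y) W) = 0 := by
  have h : C.br X (C.br Y Z) + C.br Y (C.br Z X) + C.br Z (C.br X Y) = 0 := by
    rw [C.jacobi, C.br_swap Z X, C.br_swap Z (C.br X Y)]
    have : C.br Y (-C.br X Z) = -C.br Y (C.br X Z) := by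
      simp only [C.br_eq, map_neg, AddMonoidHom.neg_apply]; abel
    rw [this]; abel
  have h' := congrArg (fun U ↦ C.nab U W) h
  simp only [map_add, AddMonoidHom.add_apply, map_zero, AddMonoidHom.zero_apply] at h'
  simp only [curv_apply, map_sub]
  linear_combination (norm := module) -h'

end LeviCivitaAlgebra

/-! ### Weak Kenmotsu structures over the module of vector fields -/

/-- A weak Kenmotsu structure, in terms of its action on the module of vector fields. The function
`β` is constant along every vector field. The 1-form `η` is encoded as `g(·, ξ)`; the tensor `Q` is
determined by `f` and `ξ`, and is left out. -/
structure KenmotsuAlgebra (A Γ : Type*) [CommRing A] [Algebra ℝ A] [AddCommGroup Γ]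
    [Module A Γ] extends LeviCivitaAlgebra A Γ where
  f : Γ →ₗ[A] Γ
  ξ : Γ
  β : A
  D_β : ∀ X, D X β = 0
  f_skew : ∀ X Y, g (f X) Y = -g X (f Y)
  f_ξ : f ξ = 0
  g_ξ_ξ : g ξ ξ = 1
  nab_f : ∀ X Y, nab X (f Y) - f (nab X Y) = β • (g (f X) Y • ξ - g Y ξ • f X)
  nab_ξ : ∀ X, nab X ξ = β • (X - g X ξ • ξ)

namespace KenmotsuAlgebra

variable {A Γ : Type*} [CommRing A] [Algebra ℝ A] [AddCommGroup Γ] [Module A Γ]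
  (C : KenmotsuAlgebra A Γ)

/-- The constant curvature tensor `(X ∧ Y) Z = g(Y, Z) X - g(X, Z) Y`. -/
def wedge : Γ →ₗ[A] Γ →ₗ[A] Γ →ₗ[A] Γ :=
  LinearMap.mk₂ A
    (fun X Y ↦ (C.g Y).smulRight X - (C.g X).smulRight Y)
    (fun X X' Y ↦ by ext Z; simp; module)
    (fun a X Y ↦ by ext Z; simp; module)
    (fun X Y Y' ↦ by ext Z; simp; module)
    (fun a X Y ↦ by ext Z; simp; module)

theorem wedge_apply (X Y Z : Γ) : C.wedge X Y Z = C.g Y Z • X - C.g X Z • Y := by simp [wedge]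

/-- The reduced curvature `K = R + β² ∧`. -/
def K : Γ →ₗ[A] Γ →ₗ[A] Γ →ₗ[A] Γ := C.curv + C.β ^ 2 • C.wedge

theorem K_apply (X Y Z : Γ) :
    C.K X Y Z = C.curv X Y Z + C.β ^ 2 • (C.g Y Z • X - C.g X Z • Y) := by
  simp [K, wedge_apply]

theorem K_swap (X Y Z : Γ) : C.K X Y Z = -C.K Y X Z := by
  rw [K_apply, K_apply, C.curv_swap]; module

theorem K_bianchi (X Y Z : Γ) : C.K X Y Z + C.K Y Z X + C.K Z X Y = 0 := by
  have h := C.curv_bianchi X Y Z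
  simp only [K_apply, C.g_symm Z Y, C.g_symm Z X, C.g_symm Y X]
  linear_combination (norm := module) h

theorem g_K_skew (X Y Z W : Γ) : C.g (C.K X Y Z) W = -C.g (C.K X Y W) Z := by
  simp only [K_apply, map_add, map_smul, map_sub, LinearMap.add_apply, LinearMap.smul_apply,
    LinearMap.sub_apply, smul_eq_mul, C.g_curv_skew X Y Z W]
  ring

/-- Covariant differentiation of `∇ξ = β (id - η ⊗ ξ)` shows that `K` kills `ξ`. -/
theorem K_ξ_right (X Y : Γ) : C.K X Y C.ξ = 0 := by
  have h1 := C.metric X Y C.ξ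
  have h2 := C.metric Y X C.ξ
  have h3 : C.g (C.br X Y) C.ξ = C.g (C.nab X Y) C.ξ - C.g (C.nab Y X) C.ξ := by
    rw [C.br_eq, map_sub, LinearMap.sub_apply]
  simp only [C.nab_ξ, map_smul, map_sub, smul_eq_mul] at h1 h2
  simp only [K_apply, C.curv_apply, C.nab_ξ, C.nab_smul, map_sub, C.D_β, h1, h2, h3,
    C.g_symm Y X]
  rw [C.br_eq]
  module

/-- The Ricci identity for `f`: commuting two covariant derivatives of `f` produces terms which are
exactly those of the constant curvature tensor, so that `f` commutes with the operators `K_{X,Y}`. -/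
theorem K_f (X Y Z : Γ) : C.K X Y (C.f Z) = C.f (C.K X Y Z) := by
  have hf (X Y : Γ) : C.nab X (C.f Y) =
      C.f (C.nab X Y) + C.β • (C.g (C.f X) Y • C.ξ - C.g Y C.ξ • C.f X) := by
    rw [← C.nab_f]; abel
  have hη (X Y : Γ) : C.D X (C.g Y C.ξ) =
      C.g (C.nab X Y) C.ξ + C.β * (C.g Y X - C.g X C.ξ * C.g Y C.ξ) := by
    rw [C.metric, C.nab_ξ, map_smul, map_sub, map_smul, smul_eq_mul, smul_eq_mul]
  have hg (X Y Z : Γ) : C.D X (C.g (C.f Y) Z) = C.g (C.f (C.nab X Y)) Z + C.g (C.f Y) (C.nab X Z)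
      + C.β * (C.g (C.f X) Y * C.g C.ξ Z - C.g Y C.ξ * C.g (C.f X) Z) := by
    rw [C.metric, hf]
    simp only [map_add, map_smul, map_sub, LinearMap.add_apply, LinearMap.smul_apply,
      LinearMap.sub_apply, smul_eq_mul]
    ring
  have h3 : C.nab (C.br X Y) Z = C.nab (C.nab X Y) Z - C.nab (C.nab Y X) Z := by
    rw [C.br_eq, map_sub, AddMonoidHom.sub_apply]
  simp only [K_apply, C.curv_apply, hf, C.nab_smul, map_sub, map_add, map_smul, C.D_β, C.nab_ξ,
    hη, hg, h3]
  have hYX : C.g (C.f Y) X = -C.g (C.f X) Y := by rw [C.f_skew, C.g_symm]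
  have hZ (W : Γ) : C.g W (C.f Z) = -C.g (C.f W) Z := by rw [C.f_skew, neg_neg]
  simp only [C.br_eq, map_sub, LinearMap.sub_apply, C.g_symm C.ξ, hYX, hZ, C.g_symm Z Y,
    C.g_symm Z X]
  module

/-- The pair symmetry of curvature tensors moves `ξ` from the last slot of `K` to the first one. -/
theorem K_ξ_left (X Y : Γ) : C.K C.ξ X Y = 0 := by
  refine C.g_nondeg _ fun Z ↦ ?_
  have symm (X Y Z : Γ) : C.g (C.K C.ξ X Y) Z = C.g (C.K C.ξ Y X) Z := by
    have h := C.K_bianchi C.ξ X Y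
    rw [K_ξ_right, add_zero, C.K_swap Y] at h
    rw [add_neg_eq_zero.1 h]
  have skew (X Y Z : Γ) := C.g_K_skew C.ξ X Y Z
  have h : C.g (C.K C.ξ X Y) Z = -C.g (C.K C.ξ X Y) Z := by
    have h := symm X Y Z
    -- a trilinear form, symmetric in its first two arguments and skew in its last two, vanishes
    rwa [skew Y X Z, symm Y Z X, skew Z Y X, symm Z X Y, skew X Z Y, neg_neg] at h
  -- division by two is done with real scalars, as `A` is only known to be a real algebra
  have h2 : (2 : ℝ) • C.g (C.K C.ξ X Y) Z = 0 := by
    rw [two_smul]; nth_rewrite 1 [h]; exact neg_add_cancel _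
  have h3 := congrArg (fun a ↦ (1 / 2 : ℝ) • a) h2
  simpa [smul_smul] using h3

theorem K_ξ_mid (X Y : Γ) : C.K X C.ξ Y = 0 := by rw [K_swap, K_ξ_left, neg_zero]

/-- The second Bianchi identity, for the reduced curvature: the constant curvature tensor is
parallel. -/
theorem K_second_bianchi (X Y Z W : Γ) :
    C.nab X (C.K Y Z W) - C.K Y Z (C.nab X W) + C.K X (C.br Y Z) W
      + (C.nab Y (C.K Z X W) - C.K Z X (C.nab Y W) + C.K Y (C.br Z X) W)
      + (C.nab Z (C.K X Y W) - C.K X Y (C.nab Z W) + C.K Z (C.br X Y) W) = 0 := by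
  have h := C.curv_second_bianchi X Y Z W
  have hβ (X : Γ) : C.D X (C.β ^ 2) = 0 := by rw [pow_two, C.D_mul, C.D_β]; simp
  simp only [K_apply, map_add, map_sub, C.nab_smul, hβ, C.metric]
  have hbr (X Y W : Γ) : C.g (C.br X Y) W = C.g (C.nab X Y) W - C.g (C.nab Y X) W := by
    rw [C.br_eq, map_sub, LinearMap.sub_apply]
  simp only [hbr]
  have h1 := C.br_eq X Y
  have h2 := C.br_eq Y Z
  have h3 := C.br_eq Z X
  linear_combination (norm := module) h - (C.β ^ 2 * C.g X W) • h2 - (C.β ^ 2 * C.g Y W) • h3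
    - (C.β ^ 2 * C.g Z W) • h1

/-- The Lie derivative of `K` along `ξ`, in its first two arguments, equals its covariant
derivative: this is the second Bianchi identity with `ξ` in one slot. -/
theorem nab_ξ_K (X Y Z : Γ) :
    C.nab C.ξ (C.K X Y Z) = C.K (C.br C.ξ X) Y Z + C.K X (C.br C.ξ Y) Z
      + C.K X Y (C.nab C.ξ Z) := by
  have h := C.K_second_bianchi C.ξ X Y Z
  simp only [K_ξ_left, K_ξ_mid, map_zero] at h
  rw [C.K_swap Y, C.br_swap Y C.ξ, map_neg, LinearMap.neg_apply] at h
  linear_combination (norm := module) h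

theorem br_ξ (X : Γ) : C.br C.ξ X = C.nab C.ξ X - C.β • (X - C.g X C.ξ • C.ξ) := by
  rw [C.br_eq, C.nab_ξ]

theorem K_br_ξ_left (X Y Z : Γ) :
    C.K (C.br C.ξ X) Y Z = C.K (C.nab C.ξ X) Y Z - C.β • C.K X Y Z := by
  simp [br_ξ, K_ξ_left]

theorem K_br_ξ_mid (X Y Z : Γ) :
    C.K X (C.br C.ξ Y) Z = C.K X (C.nab C.ξ Y) Z - C.β • C.K X Y Z := by
  simp [br_ξ, K_ξ_mid]

/-- The equation `∇_ξ K = -2 β K`. -/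
theorem nab_ξ_K' (X Y Z : Γ) :
    C.nab C.ξ (C.K X Y Z) = C.K (C.nab C.ξ X) Y Z + C.K X (C.nab C.ξ Y) Z
      + C.K X Y (C.nab C.ξ Z) - (2 * C.β) • C.K X Y Z := by
  rw [nab_ξ_K, K_br_ξ_left, K_br_ξ_mid]; module

theorem nab_ξ_f (Y : Γ) : C.nab C.ξ (C.f Y) = C.f (C.nab C.ξ Y) := by
  have h := C.nab_f C.ξ Y
  simpa [C.f_ξ, sub_eq_zero] using h

theorem nab_ξ_ξ : C.nab C.ξ C.ξ = 0 := by
  rw [C.nab_ξ, C.g_ξ_ξ, one_smul, sub_self, smul_zero]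

/-- The restriction of the metric to `ker η`. -/
def gD (X Y : Γ) : A := C.g X Y - C.g X C.ξ * C.g Y C.ξ

theorem D_ξ_gD (X Y : Γ) : C.D C.ξ (C.gD X Y) = C.gD (C.nab C.ξ X) Y + C.gD X (C.nab C.ξ Y) := by
  simp only [gD, map_sub, C.D_mul, C.metric, nab_ξ_ξ, map_zero]
  ring

theorem D_ξ_g_f_f (X Y : Γ) : C.D C.ξ (C.g (C.f X) (C.f Y)) =
    C.g (C.f (C.nab C.ξ X)) (C.f Y) + C.g (C.f X) (C.f (C.nab C.ξ Y)) := by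
  rw [C.metric, nab_ξ_f, nab_ξ_f]

/-- The Lie derivative of the metric along `δ ξ`. -/
theorem lie_smul_ξ (δ : A) (X Y : Γ) :
    C.D (δ • C.ξ) (C.g X Y) - C.g (C.br (δ • C.ξ) X) Y - C.g X (C.br (δ • C.ξ) Y) =
      C.D X δ * C.g Y C.ξ + C.D Y δ * C.g X C.ξ + 2 * (δ * C.β) * C.gD X Y := by
  simp only [C.br_eq, C.nab_smul, C.nab_ξ, C.metric, map_sub, map_add, map_smul, gD,
    LinearMap.sub_apply, LinearMap.add_apply, LinearMap.smul_apply, smul_eq_mul,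
    AddMonoidHom.smul_apply]
  rw [C.g_symm C.ξ Y]
  ring

end KenmotsuAlgebra

/-! ### Smooth vector fields and orthonormal frames -/

section VectorFields

variable {E : Type*} [NormedAddCommGroup E] [NormedSpace ℝ E]
  {H : Type*} [TopologicalSpace H] (I : ModelWithCorners ℝ E H)
  {M : Type*} [TopologicalSpace M] [ChartedSpace H M] [IsManifold I ∞ M]

variable (M) in
/-- The ring of smooth real functions on `M`. -/
abbrev SmoothFun := C^∞⟮I, M; 𝓘(ℝ), ℝ⟯

variable (M) in
/-- Smooth vector fields on `M`, a module over `SmoothFun I M`. -/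
abbrev SmoothField := Cₛ^∞⟮I; E, (TangentSpace I : M → Type _)⟯

variable {I}

noncomputable instance : SMul (SmoothFun I M) (SmoothField I M) where
  smul h X := ⟨fun p ↦ h p • X p, h.contMDiff.smul_section X.contMDiff⟩

@[simp]
theorem SmoothField.smul_apply (h : SmoothFun I M) (X : SmoothField I M) (p : M) :
    (h • X) p = h p • X p := rfl

noncomputable instance : Module (SmoothFun I M) (SmoothField I M) where
  one_smul X := by ext p; simp
  mul_smul a b X := by ext p; simp [mul_smul]
  smul_zero a := by ext p; simp
  smul_add a X Y := by ext p; simp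
  add_smul a b X := by ext p; simp [add_smul]
  zero_smul X := by ext p; simp

theorem contMDiff_mvfderiv_apply (h : SmoothFun I M) (X : SmoothField I M) :
    ContMDiff I 𝓘(ℝ) ∞ fun q ↦ mvfderiv I h q (X q) := by
  have h1 := (h.contMDiff.contMDiff_tangentMap (m := ∞) (by simp)).comp X.contMDiff
  exact (contMDiff_snd_tangentBundle_modelSpace ℝ 𝓘(ℝ)).comp h1

theorem contMDiff_mlieBracket [CompleteSpace E] (X Y : SmoothField I M) :
    ContMDiff I (I.prod 𝓘(ℝ, E)) ∞ (T% (mlieBracket I X Y)) := by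
  have : IsManifold I (minSmoothness ℝ 2) M := by
    rw [minSmoothness_of_isRCLikeNormedField]; exact IsManifold.of_le (n := ∞) (by decide)
  have : IsManifold I ((⊤ : ℕ∞) + 1) M := inferInstanceAs (IsManifold I ∞ M)
  exact ContDiff.mlieBracket_vectorField (m := ⊤) (n := ⊤) X.contMDiff Y.contMDiff (by simp)

section Metric

variable [RiemannianBundle (fun p : M ↦ TangentSpace I p)]
  [IsContMDiffRiemannianBundle I ∞ E (fun p : M ↦ TangentSpace I p)]

theorem contMDiffOn_inner {u : Set M} {X Y : Π q : M, TangentSpace I q}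
    (hX : ContMDiffOn I (I.prod 𝓘(ℝ, E)) ∞ (T% X) u)
    (hY : ContMDiffOn I (I.prod 𝓘(ℝ, E)) ∞ (T% Y) u) :
    ContMDiffOn I 𝓘(ℝ) ∞ (fun q ↦ (inner ℝ (X q) (Y q) : ℝ)) u :=
  ContMDiffOn.inner_bundle (IB := I) (F := E) (E := fun p : M ↦ TangentSpace I p) hX hY

theorem contMDiff_inner {X Y : Π q : M, TangentSpace I q}
    (hX : ContMDiff I (I.prod 𝓘(ℝ, E)) ∞ (T% X))
    (hY : ContMDiff I (I.prod 𝓘(ℝ, E)) ∞ (T% Y)) :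
    ContMDiff I 𝓘(ℝ) ∞ (fun q ↦ (inner ℝ (X q) (Y q) : ℝ)) :=
  ContMDiff.inner_bundle (IB := I) (F := E) (E := fun p : M ↦ TangentSpace I p) hX hY

theorem contMDiffOn_gramSchmidt {n : ℕ} {u : Set M} {s : Fin n → Π q : M, TangentSpace I q}
    (hs : ∀ i, ContMDiffOn I (I.prod 𝓘(ℝ, E)) ∞ (T% (s i)) u)
    (hli : ∀ q ∈ u, LinearIndependent ℝ (fun i ↦ s i q)) (i : Fin n) :
    ContMDiffOn I (I.prod 𝓘(ℝ, E)) ∞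
      (T% (fun q ↦ InnerProductSpace.gramSchmidt ℝ (fun j ↦ s j q) i)) u := by
  induction i using WellFoundedLT.induction with
  | ind i ih =>
    have h (q : M) : InnerProductSpace.gramSchmidt ℝ (fun j ↦ s j q) i = (s i -
        fun q ↦ ∑ k ∈ Finset.Iio i,
          (inner ℝ (InnerProductSpace.gramSchmidt ℝ (fun j ↦ s j q) k) (s i q) /
            inner ℝ (InnerProductSpace.gramSchmidt ℝ (fun j ↦ s j q) k)
              (InnerProductSpace.gramSchmidt ℝ (fun j ↦ s j q) k) : ℝ) •
            InnerProductSpace.gramSchmidt ℝ (fun j ↦ s j q) k) q := by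
      have h1 := InnerProductSpace.gramSchmidt_def'' ℝ (fun j ↦ s j q) i
      simp only [RCLike.ofReal_real_eq_id, id, ← real_inner_self_eq_norm_sq] at h1
      rw [Pi.sub_apply, eq_sub_iff_add_eq]
      exact h1.symm
    refine ContMDiffOn.congr ?_ (fun q _ ↦ congrArg (TotalSpace.mk' E q) (h q))
    refine (hs i).sub_section (ContMDiffOn.sum_section fun k hk ↦ ?_)
    have hk' := ih k (Finset.mem_Iio.1 hk)
    refine ContMDiffOn.smul_section (ContMDiffOn.div₀ (contMDiffOn_inner hk' (hs i))
      (contMDiffOn_inner hk' hk') fun q hq ↦ ?_) hk'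
    exact inner_self_ne_zero.2 (InnerProductSpace.gramSchmidt_ne_zero k (hli q hq))

theorem contMDiffOn_inv_norm {u : Set M} {s : Π q : M, TangentSpace I q}
    (hs : ContMDiffOn I (I.prod 𝓘(ℝ, E)) ∞ (T% s) u) (h0 : ∀ q ∈ u, s q ≠ 0) :
    ContMDiffOn I 𝓘(ℝ) ∞ (fun q ↦ ‖s q‖⁻¹) u := by
  have h1 : ContMDiffOn I 𝓘(ℝ) ∞ (fun q ↦ √(inner ℝ (s q) (s q) : ℝ)) u := fun q hq ↦
    (Real.contDiffAt_sqrt (n := ∞)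
      (inner_self_ne_zero.2 (h0 q hq))).contMDiffAt.comp_contMDiffWithinAt q
      (contMDiffOn_inner hs hs q hq)
  refine (h1.inv₀ fun q hq ↦ ?_).congr fun q _ ↦ ?_
  · exact Real.sqrt_ne_zero'.2 (real_inner_self_pos.2 (h0 q hq))
  · rw [real_inner_self_eq_norm_sq, Real.sqrt_sq (norm_nonneg _)]

end Metric

variable [FiniteDimensional ℝ E] [T2Space M]

theorem exists_bump {p : M} {u : Set M} (hu : u ∈ 𝓝 p) :
    ∃ χ : SmoothFun I M, (∀ᶠ q in 𝓝 p, χ q = 1) ∧ tsupport χ ⊆ u := by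
  obtain ⟨ρ, hρ, -⟩ := (SmoothBumpFunction.nhds_basis_support (I := I) hu).mem_iff.1 hu
  exact ⟨⟨ρ, ρ.contMDiff⟩, ρ.eventuallyEq_one, hρ⟩

theorem exists_smoothField_eventuallyEq {p : M} {u : Set M} (hu : IsOpen u) (hp : p ∈ u)
    {s : Π q : M, TangentSpace I q} (hs : ContMDiffOn I (I.prod 𝓘(ℝ, E)) ∞ (T% s) u) :
    ∃ X : SmoothField I M, ∀ᶠ q in 𝓝 p, X q = s q := by
  obtain ⟨χ, h1, h2⟩ := exists_bump (I := I) (hu.mem_nhds hp)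
  refine ⟨⟨fun q ↦ χ q • s q,
    ContMDiffOn.smul_section_of_tsupport χ.contMDiff.contMDiffOn hu h2 hs⟩, ?_⟩
  filter_upwards [h1] with q hq
  change χ q • s q = s q
  rw [hq, one_smul]

theorem exists_smoothField_eventuallyEq_extend (p : M) (v : TangentSpace I p) :
    ∃ X : SmoothField I M, ∀ᶠ q in 𝓝 p, X q = extend E v q := by
  obtain ⟨u, hu, h⟩ := exists_contMDiffOn_extend (k := ∞) I E v
  obtain ⟨w, hwu, hw, hp⟩ := mem_nhds_iff.1 hu
  exact exists_smoothField_eventuallyEq hw hp (h.mono hwu)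

theorem exists_smoothField_eq (p : M) (v : TangentSpace I p) :
    ∃ X : SmoothField I M, X p = v := by
  obtain ⟨X, hX⟩ := exists_smoothField_eventuallyEq_extend p v
  exact ⟨X, by rw [hX.self_of_nhds, extend_apply_self]⟩

section Metric

variable [RiemannianBundle (fun p : M ↦ TangentSpace I p)]
  [IsContMDiffRiemannianBundle I ∞ E (fun p : M ↦ TangentSpace I p)]

/-- Near every point there is an orthonormal frame; its members are restrictions of globally
defined smooth vector fields. -/
theorem exists_orthonormal_frame (p : M) :
    ∃ e : Fin (Module.finrank ℝ E) → SmoothField I M,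
      ∀ᶠ q in 𝓝 p, Orthonormal ℝ (fun i ↦ e i q) := by
  set t := trivializationAt E (TangentSpace I : M → Type _) p
  set b := Module.finBasis ℝ E
  have hp : p ∈ t.baseSet := FiberBundle.mem_baseSet_trivializationAt' p
  have hfr := t.isLocalFrameOn_localFrame_baseSet I ∞ b
  have hgs := contMDiffOn_gramSchmidt (fun i ↦ hfr.contMDiffOn i)
    (fun q hq ↦ hfr.linearIndependent hq)
  have hN (i) : ContMDiffOn I (I.prod 𝓘(ℝ, E)) ∞
      (T% (fun q ↦ InnerProductSpace.gramSchmidtNormed ℝ (fun j ↦ t.localFrame b j q) i))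
      t.baseSet := by
    refine ContMDiffOn.smul_section (f := fun q ↦
      ‖InnerProductSpace.gramSchmidt ℝ (fun j ↦ t.localFrame b j q) i‖⁻¹) ?_ (hgs i)
    exact contMDiffOn_inv_norm (hgs i) fun q hq ↦
      InnerProductSpace.gramSchmidt_ne_zero i (hfr.linearIndependent hq)
  choose e he using fun i ↦ exists_smoothField_eventuallyEq t.open_baseSet hp (hN i)
  refine ⟨e, ?_⟩
  filter_upwards [Filter.eventually_all.2 he, t.open_baseSet.mem_nhds hp] with q hq hqb
  simp only [hq]
  exact InnerProductSpace.gramSchmidtNormed_orthonormal (hfr.linearIndependent hqb)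

omit [IsManifold I ∞ M] [T2Space M]
  [IsContMDiffRiemannianBundle I ∞ E (fun p : M ↦ TangentSpace I p)] in
theorem exists_orthonormalBasis_coe_eq {q : M}
    {e : Fin (Module.finrank ℝ E) → TangentSpace I q} (he : Orthonormal ℝ e) :
    ∃ b : OrthonormalBasis (Fin (Module.finrank ℝ E)) ℝ (TangentSpace I q), ⇑b = e := by
  have hcard : Module.finrank ℝ (TangentSpace I q) =
      Fintype.card (Fin (Module.finrank ℝ E)) := by
    rw [Fintype.card_fin]; rfl
  obtain ⟨b, hb⟩ := (he.comp (fun i : ↥(Set.univ : Set (Fin (Module.finrank ℝ E))) ↦ i.1)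
    Subtype.val_injective).exists_orthonormalBasis_extension_of_card_eq hcard (v := e)
  exact ⟨b, funext fun i ↦ hb i (Set.mem_univ i)⟩

/-- A vector field is smooth if its inner products with smooth vector fields are. -/
theorem contMDiff_of_inner {W : Π q : M, TangentSpace I q}
    (h : ∀ Z : SmoothField I M, ContMDiff I 𝓘(ℝ) ∞ fun q ↦ inner ℝ (Z q) (W q)) :
    ContMDiff I (I.prod 𝓘(ℝ, E)) ∞ (T% W) := by
  intro p
  obtain ⟨e, he⟩ := exists_orthonormal_frame (I := I) p
  have h1 : ContMDiff I (I.prod 𝓘(ℝ, E)) ∞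
      (T% (fun q ↦ ∑ i, (inner ℝ (e i q) (W q) : ℝ) • e i q)) :=
    ContMDiff.sum_section fun i _ ↦ ContMDiff.smul_section (h (e i)) (e i).contMDiff
  refine h1.contMDiffAt.congr_of_eventuallyEq ?_
  filter_upwards [he] with q hq
  obtain ⟨b, hb⟩ := exists_orthonormalBasis_coe_eq hq
  have h2 := b.sum_repr' (W q)
  simp only [hb] at h2
  rw [h2]

/-- The Koszul formula expresses the inner products of `∇_X Y` through smooth functions. -/
theorem contMDiff_leviCivita (X Y : SmoothField I M) :
    ContMDiff I (I.prod 𝓘(ℝ, E)) ∞ (T% (fun q ↦ leviCivita I M Y q (X q))) := by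
  have : CompleteSpace E := FiniteDimensional.complete ℝ E
  refine contMDiff_of_inner fun Z ↦ ?_
  have h (q : M) : inner ℝ (Z q) (leviCivita I M Y q (X q)) = 1 / 2 * koszul I X Y Z q := by
    rw [real_inner_comm]
    exact inner_leviCivitaFun I X.mdifferentiableAt Y.mdifferentiableAt Z.mdifferentiableAt
  simp only [h, koszul]
  have hd (X Y Z : SmoothField I M) :
      ContMDiff I 𝓘(ℝ) ∞ fun q ↦ mvfderiv I (fun q ↦ inner ℝ (Y q) (Z q)) q (X q) :=
    contMDiff_mvfderiv_apply ⟨_, contMDiff_inner Y.contMDiff Z.contMDiff⟩ X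
  have hb (X Y Z : SmoothField I M) :
      ContMDiff I 𝓘(ℝ) ∞ fun q ↦ (inner ℝ (mlieBracket I X Y q) (Z q) : ℝ) :=
    contMDiff_inner (contMDiff_mlieBracket X Y) Z.contMDiff
  exact contMDiff_const.mul ((((((hd X Y Z).add (hd Y X Z)).sub (hd Z X Y)).add (hb X Y Z)).sub
    (hb X Z Y)).sub (hb Y Z X))

end Metric
end VectorFields

/-! ### The Levi-Civita connection on smooth vector fields -/

section Concrete

variable {E : Type*} [NormedAddCommGroup E] [NormedSpace ℝ E]
  {H : Type*} [TopologicalSpace H] (I : ModelWithCorners ℝ E H)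
  {M : Type*} [TopologicalSpace M] [ChartedSpace H M] [IsManifold I ∞ M]

instance : IsScalarTower ℝ (SmoothFun I M) (SmoothField I M) where
  smul_assoc c h X := by ext p; simp [mul_smul]

section Bracket
variable {I}

omit [IsManifold I ∞ M] in
theorem SmoothFun.mdifferentiableAt (h : SmoothFun I M) (p : M) :
    MDifferentiableAt I 𝓘(ℝ) h p :=
  h.contMDiff.mdifferentiableAt (by simp)

variable [FiniteDimensional ℝ E]

theorem mlieBracket_jacobi (X Y Z : SmoothField I M) (p : M) :
    mlieBracket I X (mlieBracket I Y Z) p =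
      mlieBracket I (mlieBracket I X Y) Z p + mlieBracket I Y (mlieBracket I X Z) p := by
  have : CompleteSpace E := FiniteDimensional.complete ℝ E
  have : IsManifold I (minSmoothness ℝ 3) M := by
    rw [minSmoothness_of_isRCLikeNormedField]; exact IsManifold.of_le (n := ∞) (by decide)
  have h2 : minSmoothness ℝ 2 ≤ ∞ := by rw [minSmoothness_of_isRCLikeNormedField]; decide
  exact leibniz_identity_mlieBracket_apply (X.contMDiff.of_le h2 p) (Y.contMDiff.of_le h2 p)
    (Z.contMDiff.of_le h2 p)

/-- A vector field acts on functions by a derivation, and the Lie bracket is the commutator: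
this follows from the Jacobi identity for `X`, `Y` and `h Z`. -/
theorem mvfderiv_mlieBracket [T2Space M] (X Y : SmoothField I M) (h : SmoothFun I M) (p : M) :
    mvfderiv I h p (mlieBracket I X Y p) =
      mvfderiv I (fun q ↦ mvfderiv I h q (Y q)) p (X p)
        - mvfderiv I (fun q ↦ mvfderiv I h q (X q)) p (Y p) := by
  have : CompleteSpace E := FiniteDimensional.complete ℝ E
  have : IsManifold I 2 M := IsManifold.of_le (n := ∞) (by decide)
  -- the identity is read off from the coefficient of `Z p`, which has to be nonzero
  by_cases hv : ∃ v : TangentSpace I p, v ≠ 0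
  swap
  · push Not at hv
    rw [hv (X p), hv (Y p), hv (mlieBracket I X Y p)]; simp
  obtain ⟨v, hv⟩ := hv
  obtain ⟨Z, rfl⟩ := exists_smoothField_eq p v
  have hbr (X Y : SmoothField I M) (q : M) :
      MDifferentiableAt I (I.prod 𝓘(ℝ, E)) (T% (mlieBracket I X Y)) q :=
    (contMDiff_mlieBracket X Y).mdifferentiableAt (by simp)
  have hd (X : SmoothField I M) (q : M) :
      MDifferentiableAt I 𝓘(ℝ) (fun q ↦ mvfderiv I h q (X q)) q :=
    (contMDiff_mvfderiv_apply h X).mdifferentiableAt (by simp)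
  have key (X : SmoothField I M) : mlieBracket I X (h • Z : SmoothField I M) =
      (fun q ↦ mvfderiv I h q (X q)) • ⇑Z + ⇑h • mlieBracket I X Z := by
    funext q
    exact mlieBracket_smul_right (h.mdifferentiableAt q) Z.mdifferentiableAt
  have key' (W : Π q : M, TangentSpace I q) : mlieBracket I W (h • Z : SmoothField I M) p =
      mvfderiv I h p (W p) • Z p + h p • mlieBracket I W Z p :=
    mlieBracket_smul_right (h.mdifferentiableAt p) Z.mdifferentiableAt
  have key2 (X Y : SmoothField I M) :
      mlieBracket I X (mlieBracket I Y (h • Z : SmoothField I M)) p =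
      mvfderiv I (fun q ↦ mvfderiv I h q (Y q)) p (X p) • Z p
        + mvfderiv I h p (Y p) • mlieBracket I X Z p
        + (mvfderiv I h p (X p) • mlieBracket I Y Z p
          + h p • mlieBracket I X (mlieBracket I Y Z) p) := by
    rw [key Y, mlieBracket_add_right
      (MDifferentiableAt.smul_section (hd Y p) Z.mdifferentiableAt)
      (MDifferentiableAt.smul_section (h.mdifferentiableAt p) (hbr Y Z p)),
      mlieBracket_smul_right (hd Y p) Z.mdifferentiableAt,
      mlieBracket_smul_right (h.mdifferentiableAt p) (hbr Y Z p)]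
  have hJ := mlieBracket_jacobi X Y (h • Z) p
  rw [key2, key2, key', mlieBracket_jacobi X Y Z p] at hJ
  have h0 : (mvfderiv I (fun q ↦ mvfderiv I h q (Y q)) p (X p)
      - mvfderiv I (fun q ↦ mvfderiv I h q (X q)) p (Y p)
      - mvfderiv I h p (mlieBracket I X Y p)) • Z p = 0 := by
    linear_combination (norm := module) hJ
  have := (smul_eq_zero.1 h0).resolve_right hv
  linarith

end Bracket

variable [FiniteDimensional ℝ E] [T2Space M]
  [RiemannianBundle (fun p : M ↦ TangentSpace I p)]
  [IsContMDiffRiemannianBundle I ∞ E (fun p : M ↦ TangentSpace I p)]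

variable (M) in
/-- The Levi-Civita connection of a Riemannian manifold, acting on smooth vector fields. -/
noncomputable def leviCivitaAlgebra : LeviCivitaAlgebra (SmoothFun I M) (SmoothField I M) where
  D :=
    { toFun X :=
        { toFun h := ⟨fun q ↦ mvfderiv I h q (X q), contMDiff_mvfderiv_apply h X⟩
          map_zero' := by
            ext q
            exact congrArg (fun A : TangentSpace I q →L[ℝ] ℝ ↦ A (X q)) (mvfderiv_zero (x := q))
          map_add' a b := by
            ext q
            exact congrArg (fun A : TangentSpace I q →L[ℝ] ℝ ↦ A (X q))
              (mvfderiv_add (a.mdifferentiableAt q) (b.mdifferentiableAt q)) }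
      map_add' X Y := by ext h q; exact map_add (mvfderiv I h q) (X q) (Y q)
      map_smul' a X := by ext h q; exact map_smul (mvfderiv I h q) (a q) (X q) }
  br X Y := ⟨mlieBracket I X Y,
    haveI : CompleteSpace E := FiniteDimensional.complete ℝ E
    contMDiff_mlieBracket X Y⟩
  g := LinearMap.mk₂ _
    (fun X Y ↦ ⟨fun q ↦ inner ℝ (X q) (Y q), contMDiff_inner X.contMDiff Y.contMDiff⟩)
    (fun X X' Y ↦ by ext q; exact inner_add_left (𝕜 := ℝ) (X q) (X' q) (Y q))
    (fun a X Y ↦ by ext q; exact real_inner_smul_left (X q) (Y q) (a q))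
    (fun X Y Y' ↦ by ext q; exact inner_add_right (𝕜 := ℝ) (X q) (Y q) (Y' q))
    (fun a X Y ↦ by ext q; exact real_inner_smul_right (X q) (Y q) (a q))
  nab :=
    { toFun X :=
        { toFun Y := ⟨fun q ↦ leviCivita I M Y q (X q), contMDiff_leviCivita X Y⟩
          map_zero' := by
            ext q
            exact congrArg (fun A ↦ A q (X q)) (leviCivita I M).zero
          map_add' Y Z := by
            ext q
            exact congrArg (fun A : TangentSpace I q →L[ℝ] TangentSpace I q ↦ A (X q))
              ((leviCivita I M).isCovariantDerivativeOnUniv.add Y.mdifferentiableAt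
                Z.mdifferentiableAt) }
      map_add' X Y := by ext Z q; exact map_add (leviCivita I M Z q) (X q) (Y q)
      map_smul' a X := by ext Z q; exact map_smul (leviCivita I M Z q) (a q) (X q) }
  D_mul X a b := by
    ext q
    exact congrArg (fun A : TangentSpace I q →L[ℝ] ℝ ↦ A (X q))
      (mvfderiv_mul (a.mdifferentiableAt q) (b.mdifferentiableAt q))
  D_br X Y a := by ext q; exact mvfderiv_mlieBracket X Y a q
  jacobi X Y Z := by ext q; exact mlieBracket_jacobi X Y Z q
  nab_smul X a Y := by
    ext q
    have h := congrArg (fun A : TangentSpace I q →L[ℝ] TangentSpace I q ↦ A (X q))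
      ((leviCivita I M).isCovariantDerivativeOnUniv.leibniz Y.mdifferentiableAt
        (a.mdifferentiableAt q))
    refine h.trans ?_
    exact add_comm _ _
  torsion X Y := by
    ext q; exact leviCivita_torsion_free I X.mdifferentiableAt Y.mdifferentiableAt
  metric X Y Z := by
    ext q; exact leviCivita_metric I X.mdifferentiableAt Y.mdifferentiableAt Z.mdifferentiableAt
  g_symm X Y := by ext q; exact real_inner_comm (Y q) (X q)
  g_nondeg X h := by
    ext q
    exact inner_self_eq_zero.1 (congrArg (fun a : SmoothFun I M ↦ a q) (h X))

section Apply
variable {I}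

theorem leviCivitaAlgebra_curv_apply (X Y Z : SmoothField I M) (q : M) :
    (leviCivitaAlgebra I M).curv X Y Z q = curvature I X Y Z q := rfl

end Apply

/-! ### Tensors at a point -/

section Germs
variable {I}

omit [T2Space M] in
theorem leviCivita_congr {Y Y' : Π q : M, TangentSpace I q} {p : M} (h : Y =ᶠ[𝓝 p] Y') :
    leviCivita I M Y p = leviCivita I M Y' p := by
  have hT : (T% Y) =ᶠ[𝓝 p] (T% Y') := h.mono fun q hq ↦ congrArg (TotalSpace.mk' E q) hq
  by_cases hY : MDiffAt (T% Y) p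
  · exact (leviCivita I M).isCovariantDerivativeOnUniv.congr_of_eventuallyEq hY
      (hY.congr_of_eventuallyEq hT.symm) Filter.univ_mem h
  · have hY' : ¬ MDiffAt (T% Y') p := fun h' ↦ hY (h'.congr_of_eventuallyEq hT)
    change leviCivitaFun I Y p = leviCivitaFun I Y' p
    rw [leviCivitaFun, leviCivitaFun, dif_neg hY, dif_neg hY']

omit [T2Space M] in
theorem curvature_congr {X X' Y Y' Z Z' : Π q : M, TangentSpace I q} {p : M}
    (hX : X =ᶠ[𝓝 p] X') (hY : Y =ᶠ[𝓝 p] Y') (hZ : Z =ᶠ[𝓝 p] Z') :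
    curvature I X Y Z p = curvature I X' Y' Z' p := by
  have h {X X' : Π q : M, TangentSpace I q} (hX : X =ᶠ[𝓝 p] X') :
      (fun q ↦ leviCivita I M Z q (X q)) =ᶠ[𝓝 p] fun q ↦ leviCivita I M Z' q (X' q) := by
    filter_upwards [hX, hZ.eventuallyEq_nhds] with q h1 h2
    rw [h1, leviCivita_congr h2]
  rw [curvature, curvature, leviCivita_congr (h hX), leviCivita_congr (h hY),
    leviCivita_congr hZ, hX.mlieBracket_vectorField_eq hY, hX.self_of_nhds, hY.self_of_nhds]

end Germs

section Tensors
variable {I}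

/-- A `C^∞`-linear operation on vector fields depends only on the value of the field at a point. -/
theorem apply_eq_zero_of_eq_zero (Φ : SmoothField I M →ₗ[SmoothFun I M] SmoothField I M)
    {X : SmoothField I M} {p : M} (hX : X p = 0) : Φ X p = 0 := by
  obtain ⟨e, he⟩ := exists_orthonormal_frame (I := I) p
  set G := (leviCivitaAlgebra I M).g
  -- `Y` vanishes near `p`, and the coefficients of `X - Y` in the frame vanish at `p`
  set Y : SmoothField I M := X - ∑ i, G (e i) X • e i with hYdef
  have hsum (q : M) : (∑ i, G (e i) X • e i : SmoothField I M) q =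
      ∑ i, (inner ℝ (e i q) (X q) : ℝ) • e i q := by
    have := map_sum (ContMDiffSection.coeAddHom I E ∞ (TangentSpace I : M → Type _))
      (fun i ↦ G (e i) X • e i) Finset.univ
    exact (congrFun this q).trans (Finset.sum_apply _ _ _)
  have hY : ∀ᶠ q in 𝓝 p, Y q = 0 := by
    filter_upwards [he] with q hq
    obtain ⟨b, hb⟩ := exists_orthonormalBasis_coe_eq hq
    have h2 := b.sum_repr' (X q)
    simp only [hb] at h2
    change X q - (∑ i, G (e i) X • e i : SmoothField I M) q = 0
    rw [hsum, h2, sub_self]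
  obtain ⟨χ, h1, h2⟩ := exists_bump (I := I) hY
  have h3 : χ • Y = 0 := by
    ext q
    by_cases hq : q ∈ tsupport χ
    · change χ q • Y q = 0
      rw [h2 hq, smul_zero]
    · change χ q • Y q = 0
      rw [image_eq_zero_of_notMem_tsupport hq, zero_smul]
  have h4 : Φ Y p = 0 := by
    have h5 : (χ • Φ Y) p = 0 := by rw [← map_smul, h3, map_zero]; rfl
    have h6 : χ p • Φ Y p = 0 := h5
    rwa [h1.self_of_nhds, one_smul] at h6
  have h7 : X = Y + ∑ i, G (e i) X • e i := by rw [hYdef]; abel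
  rw [h7, map_add, map_sum]
  have h8 := map_sum (ContMDiffSection.coeAddHom I E ∞ (TangentSpace I : M → Type _))
      (fun i ↦ Φ (G (e i) X • e i)) Finset.univ
  have h9 := (congrFun h8 p).trans (Finset.sum_apply _ _ _)
  change Φ Y p + (∑ i, Φ (G (e i) X • e i) : SmoothField I M) p = 0
  refine (congrArg₂ (· + ·) h4 h9).trans ?_
  rw [zero_add]
  refine Finset.sum_eq_zero fun i _ ↦ ?_
  rw [map_smul]
  change (inner ℝ (e i p) (X p) : ℝ) • Φ (e i) p = 0
  rw [hX, inner_zero_right, zero_smul]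

theorem apply_congr (Φ : SmoothField I M →ₗ[SmoothFun I M] SmoothField I M)
    {X Y : SmoothField I M} {p : M} (h : X p = Y p) : Φ X p = Φ Y p := by
  have h1 : Φ (X - Y) p = 0 := apply_eq_zero_of_eq_zero Φ (sub_eq_zero.2 h)
  rw [map_sub] at h1
  exact sub_eq_zero.1 h1

/-- Evaluation of vector fields at a point. -/
noncomputable def evalAt (p : M) : SmoothField I M →ₗ[ℝ] TangentSpace I p where
  toFun X := X p
  map_add' _ _ := rfl
  map_smul' _ _ := rfl

/-- A linear choice of smooth vector fields with prescribed value at a point. -/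
noncomputable def fieldThrough (p : M) : TangentSpace I p →ₗ[ℝ] SmoothField I M :=
  (Module.finBasis ℝ (TangentSpace I p)).constr ℝ fun i ↦
    (exists_smoothField_eq p (Module.finBasis ℝ (TangentSpace I p) i)).choose

omit [RiemannianBundle (fun p : M ↦ TangentSpace I p)]
  [IsContMDiffRiemannianBundle I ∞ E (fun p : M ↦ TangentSpace I p)] in
theorem fieldThrough_apply (p : M) (v : TangentSpace I p) : fieldThrough (I := I) p v p = v := by
  have h : evalAt p ∘ₗ fieldThrough (I := I) p = LinearMap.id := by
    refine (Module.finBasis ℝ (TangentSpace I p)).ext fun i ↦ ?_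
    rw [LinearMap.comp_apply, fieldThrough, Module.Basis.constr_basis]
    exact (exists_smoothField_eq p (Module.finBasis ℝ (TangentSpace I p) i)).choose_spec
  exact LinearMap.congr_fun h v

/-- The value at a point of a `C^∞`-trilinear operation on vector fields. -/
noncomputable def tensorAt (L : SmoothField I M →ₗ[SmoothFun I M] SmoothField I M
      →ₗ[SmoothFun I M] SmoothField I M →ₗ[SmoothFun I M] SmoothField I M) (p : M) :
    TangentSpace I p →ₗ[ℝ] TangentSpace I p →ₗ[ℝ] TangentSpace I p →ₗ[ℝ] TangentSpace I p :=
  LinearMap.mk₂ ℝ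
    (fun u v ↦ evalAt p ∘ₗ
      (L (fieldThrough p u) (fieldThrough p v)).restrictScalars ℝ ∘ₗ fieldThrough p)
    (fun u u' v ↦ by ext w; simp)
    (fun c u v ↦ by ext w; simp [LinearMap.map_smul_of_tower])
    (fun u v v' ↦ by ext w; simp)
    (fun c u v ↦ by ext w; simp [LinearMap.map_smul_of_tower])

theorem tensorAt_apply (L : SmoothField I M →ₗ[SmoothFun I M] SmoothField I M
      →ₗ[SmoothFun I M] SmoothField I M →ₗ[SmoothFun I M] SmoothField I M) (p : M)
    (X Y Z : SmoothField I M) : tensorAt L p (X p) (Y p) (Z p) = L X Y Z p := by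
  change L (fieldThrough p (X p)) (fieldThrough p (Y p)) (fieldThrough p (Z p)) p = _
  refine (apply_congr (L _ _) (fieldThrough_apply p (Z p))).trans ?_
  refine (apply_congr ((L _).flip Z) (fieldThrough_apply p (Y p))).trans ?_
  exact apply_congr ((L.flip Y).flip Z) (fieldThrough_apply p (X p))

/-- The curvature at a point, defined with local extensions, is the value of the tensor. -/
theorem curvatureAt_eq (p : M) (u v w : TangentSpace I p) :
    curvatureAt I p u v w = tensorAt (leviCivitaAlgebra I M).curv p u v w := by
  obtain ⟨X, hX⟩ := exists_smoothField_eventuallyEq_extend p u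
  obtain ⟨Y, hY⟩ := exists_smoothField_eventuallyEq_extend p v
  obtain ⟨Z, hZ⟩ := exists_smoothField_eventuallyEq_extend p w
  have h := tensorAt_apply (leviCivitaAlgebra I M).curv p X Y Z
  rw [hX.self_of_nhds, hY.self_of_nhds, hZ.self_of_nhds, extend_apply_self, extend_apply_self,
    extend_apply_self] at h
  rw [h, leviCivitaAlgebra_curv_apply]
  exact (curvature_congr hX hY hZ).symm

end Tensors
end Concrete

/-! ### Traces of reduced curvature tensors -/

section Traces

variable {V : Type*} [NormedAddCommGroup V] [InnerProductSpace ℝ V] {ι : Type*} [Fintype ι]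

/-- The trace of a linear map is unchanged, to first order, by an infinitesimal rotation of the
orthonormal basis in which it is computed. -/
theorem sum_inner_add_inner_eq_zero_of_skew (b : OrthonormalBasis ι ℝ V) (a : ι → V)
    (ha : ∀ i j, inner ℝ (a i) (b j) + inner ℝ (b i) (a j) = (0 : ℝ)) (L : V →ₗ[ℝ] V) :
    ∑ i, (inner ℝ (L (a i)) (b i) + inner ℝ (L (b i)) (a i) : ℝ) = 0 := by
  have h1 (i : ι) : (inner ℝ (L (a i)) (b i) : ℝ) =
      ∑ j, inner ℝ (b j) (a i) * inner ℝ (L (b j)) (b i) := by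
    conv_lhs => rw [← b.sum_repr' (a i)]
    simp [sum_inner, real_inner_smul_left]
  have h2 (i : ι) : (inner ℝ (L (b i)) (a i) : ℝ) =
      ∑ j, inner ℝ (b j) (a i) * inner ℝ (L (b i)) (b j) := by
    conv_lhs => rw [← b.sum_repr' (a i)]
    simp [inner_sum, real_inner_smul_right]
  rw [Finset.sum_add_distrib]
  simp only [h1, h2]
  rw [Finset.sum_comm, ← Finset.sum_add_distrib]
  refine Finset.sum_eq_zero fun i _ ↦ ?_
  rw [← Finset.sum_add_distrib]
  refine Finset.sum_eq_zero fun j _ ↦ ?_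
  rw [← add_mul, real_inner_comm (a i) (b j), add_comm, ha, zero_mul]

/-- The algebraic symmetries of the reduced curvature of a weak Kenmotsu manifold at a point: it is
a curvature tensor that commutes with the skew map `f`. -/
structure IsReducedCurvature (K : V →ₗ[ℝ] V →ₗ[ℝ] V →ₗ[ℝ] V) (f : V →ₗ[ℝ] V) : Prop where
  swap : ∀ x y z, K x y z = -K y x z
  skew : ∀ x y z w, (inner ℝ (K x y z) w : ℝ) = -inner ℝ (K x y w) z
  bianchi : ∀ x y z, K x y z + K y z x + K z x y = 0
  f_skew : ∀ x y, (inner ℝ (f x) y : ℝ) = -inner ℝ x (f y)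
  comm : ∀ x y z, K x y (f z) = f (K x y z)

/-- The Ricci contraction `tr (z ↦ K_{z,u} v)` of a trilinear map. -/
noncomputable def ricciContraction (K : V →ₗ[ℝ] V →ₗ[ℝ] V →ₗ[ℝ] V) (u v : V) : ℝ :=
  LinearMap.trace ℝ V ((K.flip u).flip v)

theorem ricciContraction_eq_sum (K : V →ₗ[ℝ] V →ₗ[ℝ] V →ₗ[ℝ] V) (b : OrthonormalBasis ι ℝ V)
    (u v : V) : ricciContraction K u v = ∑ i, inner ℝ (K (b i) u v) (b i) := by
  rw [ricciContraction, LinearMap.trace_eq_sum_inner _ b]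
  exact Finset.sum_congr rfl fun i _ ↦ real_inner_comm _ _

namespace IsReducedCurvature

variable {K : V →ₗ[ℝ] V →ₗ[ℝ] V →ₗ[ℝ] V} {f : V →ₗ[ℝ] V} (h : IsReducedCurvature K f)
include h

theorem pair_symm (x y z w : V) : (inner ℝ (K x y z) w : ℝ) = inner ℝ (K z w x) y := by
  have B (x y z w : V) :
      (inner ℝ (K x y z) w + inner ℝ (K y z x) w + inner ℝ (K z x y) w : ℝ) = 0 := by
    rw [← inner_add_left, ← inner_add_left, h.bianchi, inner_zero_left]
  have S (x y z w : V) : (inner ℝ (K x y z) w : ℝ) = -inner ℝ (K y x z) w := by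
    rw [h.swap, inner_neg_left]
  linarith [B x y z w, B y z w x, B z w x y, B w x y z, S x y z w, S y x z w, h.skew x y z w,
    h.skew y z x w, h.skew z x y w, h.skew y z w x, h.skew z w y x, h.skew w y z x,
    h.skew z w x y, h.skew w x z y, h.skew x z w y, h.skew w x y z, h.skew x y w z,
    h.skew y w x z, S z x y w, S x z y w, S w y z x, S y w z x, S x z w y, S y w x z]

/-- Pair symmetry turns commutation with `f` into a rule for the first two arguments. -/
theorem map_left (x y z : V) : K (f x) y z = -K x (f y) z := by
  refine ext_inner_right ℝ fun w ↦ ?_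
  rw [inner_neg_left, h.pair_symm, h.pair_symm x (f y), h.comm, h.f_skew]

variable [FiniteDimensional ℝ V]

theorem ricciContraction_symm (u v : V) :
    ricciContraction K u v = ricciContraction K v u := by
  simp only [ricciContraction_eq_sum K (stdOrthonormalBasis ℝ V)]
  refine Finset.sum_congr rfl fun i _ ↦ ?_
  rw [h.pair_symm, h.swap, inner_neg_left, h.skew, neg_neg]

theorem trace_comp_sq (u v : V) :
    LinearMap.trace ℝ V ((K.flip u).flip v ∘ₗ f ∘ₗ f) = ricciContraction K u (f (f v)) := by
  rw [LinearMap.trace_comp_comm', ricciContraction]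
  congr 1
  ext x
  simp [h.comm]

theorem ricciContraction_sq_left (u v : V) :
    ricciContraction K v (f (f u)) = ricciContraction K u (f (f v)) := by
  rw [h.ricciContraction_symm, ← h.trace_comp_sq, ricciContraction]
  congr 1
  ext x
  simp only [LinearMap.flip_apply, LinearMap.comp_apply]
  rw [h.map_left, h.map_left, neg_neg]

/-- Bianchi's identity turns the trace of `K_{u,f v} ∘ f` into a Ricci contraction. -/
theorem sum_inner_map_map (b : OrthonormalBasis ι ℝ V) (u v : V) :
    ∑ i, (inner ℝ (K u (f v) (f (b i))) (b i) : ℝ) = -2 * ricciContraction K u (f (f v)) := by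
  have h1 (x : V) : K u (f v) (f x) =
      -((K.flip v).flip u ∘ₗ f ∘ₗ f) x - (f ∘ₗ (K.flip u).flip v ∘ₗ f) x := by
    have hb := h.bianchi u (f v) (f x)
    simp only [LinearMap.flip_apply, LinearMap.comp_apply]
    rw [← h.comm (f x), h.map_left (f x) v, ← h.swap (f v)]
    linear_combination (norm := module) hb
  have h2 : LinearMap.trace ℝ V (f ∘ₗ (K.flip u).flip v ∘ₗ f) =
      ricciContraction K u (f (f v)) := by
    rw [← h.trace_comp_sq, LinearMap.trace_comp_comm', LinearMap.comp_assoc]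
  simp only [h1, inner_sub_left, inner_neg_left, Finset.sum_sub_distrib, Finset.sum_neg_distrib]
  have h3 (L : V →ₗ[ℝ] V) : ∑ i, (inner ℝ (L (b i)) (b i) : ℝ) = LinearMap.trace ℝ V L := by
    rw [LinearMap.trace_eq_sum_inner _ b]
    exact Finset.sum_congr rfl fun i _ ↦ real_inner_comm _ _
  rw [h3, h3, h2, h.trace_comp_sq, h.ricciContraction_sq_left]
  ring

end IsReducedCurvature
end Traces

/-! ### The structure tensors of a weak almost contact metric manifold -/

namespace WeakAlmostContactMetric

section Pointwise

variable {E : Type*} [NormedAddCommGroup E] [NormedSpace ℝ E]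
  {H : Type*} [TopologicalSpace H] {I : ModelWithCorners ℝ E H}
  {M : Type*} [TopologicalSpace M] [ChartedSpace H M] [IsManifold I ∞ M]
  [RiemannianBundle (fun p : M ↦ TangentSpace I p)] {n : ℕ}
  (S : WeakAlmostContactMetric I M n)

/-- The kernel of `f` is spanned by `ξ`. -/
theorem eq_of_f_eq_zero {p : M} {v : TangentSpace I p} (h : S.f p v = 0) :
    v = S.η p v • S.ξ p := by
  have h1 := S.f_sq p v
  rw [h, map_zero, eq_comm, neg_add_eq_zero] at h1
  refine (S.bijective_Q p).1 ?_
  rw [h1, map_smul, S.Q_ξ]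

theorem f_ξ (p : M) : S.f p (S.ξ p) = 0 := by
  have h1 : S.f p (S.f p (S.ξ p)) = 0 := by rw [S.f_sq, S.Q_ξ, S.η_ξ, one_smul, neg_add_cancel]
  obtain ⟨c, hc⟩ : ∃ c : ℝ, S.f p (S.ξ p) = c • S.ξ p := ⟨_, S.eq_of_f_eq_zero h1⟩
  rw [hc, map_smul, hc, smul_smul] at h1
  have h3 := congrArg (S.η p) h1
  rw [map_smul, S.η_ξ, map_zero, smul_eq_mul, mul_one, mul_self_eq_zero] at h3
  rw [hc, h3, zero_smul]

theorem η_f_apply (p : M) (v : TangentSpace I p) : S.η p (S.f p v) = 0 := by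
  have h := S.η_f p (v - S.η p v • S.ξ p) (by simp [S.η_ξ])
  simpa [S.f_ξ] using h

theorem inner_ξ (p : M) (v : TangentSpace I p) : inner ℝ v (S.ξ p) = S.η p v := by
  have h := S.inner_f_f p v (S.ξ p)
  rw [S.f_ξ, inner_zero_right, S.Q_ξ, S.η_ξ, mul_one] at h
  linarith

theorem Q_eq (p : M) (v : TangentSpace I p) :
    S.Q p v = -S.f p (S.f p v) + S.η p v • S.ξ p := by
  rw [S.f_sq]; abel

theorem f_Q (p : M) (v : TangentSpace I p) : S.f p (S.Q p v) = S.Q p (S.f p v) := by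
  rw [Q_eq, Q_eq, map_add, map_neg, map_smul, S.f_ξ, S.η_f_apply, smul_zero, zero_smul]

theorem f_skew (p : M) (u v : TangentSpace I p) :
    (inner ℝ (S.f p u) v : ℝ) = -inner ℝ u (S.f p v) := by
  obtain ⟨w, rfl⟩ := (S.bijective_Q p).2 v
  have h := S.inner_f_f p u (S.f p w)
  rw [S.η_f_apply, mul_zero, sub_zero, ← S.f_Q, S.f_sq, inner_add_right, inner_neg_right,
    inner_smul_right, S.inner_ξ, S.η_f_apply, mul_zero, add_zero] at h
  rw [← h, neg_neg]

end Pointwise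

section Kenmotsu

variable {E : Type*} [NormedAddCommGroup E] [NormedSpace ℝ E] [FiniteDimensional ℝ E]
  {H : Type*} [TopologicalSpace H] {I : ModelWithCorners ℝ E H}
  {M : Type*} [TopologicalSpace M] [ChartedSpace H M] [IsManifold I ∞ M] [T2Space M]
  [RiemannianBundle (fun p : M ↦ TangentSpace I p)]
  [IsContMDiffRiemannianBundle I ∞ E (fun p : M ↦ TangentSpace I p)] {n : ℕ}
  (S : WeakAlmostContactMetric I M n)

/-- The tensor `f`, acting on smooth vector fields. -/
noncomputable def fieldF : SmoothField I M →ₗ[SmoothFun I M] SmoothField I M where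
  toFun X := ⟨fun q ↦ S.f q (X q), S.contMDiff_f.clm_bundle_apply X.contMDiff⟩
  map_add' X Y := by ext q; exact map_add (S.f q) (X q) (Y q)
  map_smul' a X := by ext q; exact map_smul (S.f q) (a q) (X q)

/-- The vector field `ξ` as a smooth section. -/
def fieldξ : SmoothField I M := ⟨S.ξ, S.contMDiff_ξ⟩

variable {S} {β : ℝ} (hβ : S.IsWeakKenmotsu fun _ ↦ β)
include hβ

omit [T2Space M] in
theorem leviCivita_f_sub (X Y : SmoothField I M) (p : M) :
    leviCivita I M (fun q ↦ S.f q (Y q)) p (X p) - S.f p (leviCivita I M Y p (X p)) =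
      β • ((inner ℝ (S.f p (X p)) (Y p) : ℝ) • S.ξ p - S.η p (Y p) • S.f p (X p)) :=
  hβ.covDeriv_f X Y X.contMDiff Y.contMDiff p

omit [T2Space M] in
/-- The defining equation with `Y = ξ` determines `f (∇_X ξ)`, hence `∇_X ξ` up to a multiple of
`ξ`, and `g(∇_X ξ, ξ) = 0` as `ξ` has unit length. -/
theorem leviCivita_ξ (X : SmoothField I M) (p : M) :
    leviCivita I M S.ξ p (X p) = β • (X p - S.η p (X p) • S.ξ p) := by
  have h := leviCivita_f_sub hβ X S.fieldξ p
  change leviCivita I M (fun q ↦ S.f q (S.ξ q)) p (X p) - S.f p (leviCivita I M S.ξ p (X p)) =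
      β • ((inner ℝ (S.f p (X p)) (S.ξ p) : ℝ) • S.ξ p - S.η p (S.ξ p) • S.f p (X p)) at h
  have h0 : (fun q ↦ S.f q (S.ξ q)) = 0 := funext S.f_ξ
  rw [h0, (leviCivita I M).zero, S.inner_ξ, S.η_f_apply, S.η_ξ] at h
  have h1 : S.f p (leviCivita I M S.ξ p (X p) - β • X p) = 0 := by
    have h' : (0 : TangentSpace I p) - S.f p (leviCivita I M S.ξ p (X p)) =
      β • ((0 : ℝ) • S.ξ p - (1 : ℝ) • S.f p (X p)) := h
    rw [map_sub, map_smul]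
    linear_combination (norm := module) -h'
  have h2 := S.eq_of_f_eq_zero h1
  have h3 := leviCivita_metric I X.mdifferentiableAt (S.fieldξ (M := M)).mdifferentiableAt
    (S.fieldξ (M := M)).mdifferentiableAt (p := p)
  have h4 : (fun q ↦ (inner ℝ (S.ξ q) (S.ξ q) : ℝ)) = fun _ ↦ 1 := by
    funext q; rw [S.inner_ξ, S.η_ξ]
  change mvfderiv I (fun q ↦ (inner ℝ (S.ξ q) (S.ξ q) : ℝ)) p (X p) =
    inner ℝ (leviCivita I M S.ξ p (X p)) (S.ξ p)
      + inner ℝ (S.ξ p) (leviCivita I M S.ξ p (X p)) at h3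
  rw [h4, mvfderiv_const, real_inner_comm _ (S.ξ p), S.inner_ξ] at h3
  have h5 : S.η p (leviCivita I M S.ξ p (X p)) = 0 := by
    have h3' : (0 : ℝ) = S.η p (leviCivita I M S.ξ p (X p))
      + S.η p (leviCivita I M S.ξ p (X p)) := h3
    linarith
  rw [map_sub, h5, map_smul, smul_eq_mul] at h2
  linear_combination (norm := module) h2

/-- A weak Kenmotsu manifold with constant `β`, acting on its smooth vector fields. -/
noncomputable def kenmotsuAlgebra : KenmotsuAlgebra (SmoothFun I M) (SmoothField I M) where
  toLeviCivitaAlgebra := leviCivitaAlgebra I M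
  f := S.fieldF
  ξ := S.fieldξ
  β := algebraMap ℝ _ β
  D_β X := by
    ext q
    exact congrArg (fun A : TangentSpace I q →L[ℝ] ℝ ↦ A (X q)) (mvfderiv_const β)
  f_skew X Y := by ext q; exact S.f_skew q (X q) (Y q)
  f_ξ := by ext q; exact S.f_ξ q
  g_ξ_ξ := by ext q; exact (S.inner_ξ q _).trans (S.η_ξ q)
  nab_f X Y := by
    ext q
    refine (leviCivita_f_sub hβ X Y q).trans ?_
    rw [← S.inner_ξ]; rfl
  nab_ξ X := by
    ext q
    refine (leviCivita_ξ hβ X q).trans ?_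
    rw [← S.inner_ξ]; rfl

end Kenmotsu
end WeakAlmostContactMetric

/-! ### The reduced curvature of a weak Kenmotsu manifold -/

namespace WeakAlmostContactMetric

section ReducedCurvature

variable {E : Type*} [NormedAddCommGroup E] [NormedSpace ℝ E] [FiniteDimensional ℝ E]
  {H : Type*} [TopologicalSpace H] {I : ModelWithCorners ℝ E H}
  {M : Type*} [TopologicalSpace M] [ChartedSpace H M] [IsManifold I ∞ M] [T2Space M]
  [RiemannianBundle (fun p : M ↦ TangentSpace I p)]
  [IsContMDiffRiemannianBundle I ∞ E (fun p : M ↦ TangentSpace I p)] {n : ℕ}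
  {S : WeakAlmostContactMetric I M n} {β : ℝ} (hβ : S.IsWeakKenmotsu fun _ ↦ β)

/-- The reduced curvature `K = R + β² ∧` at a point. -/
noncomputable def reducedCurvature (p : M) :
    TangentSpace I p →ₗ[ℝ] TangentSpace I p →ₗ[ℝ] TangentSpace I p →ₗ[ℝ] TangentSpace I p :=
  tensorAt (kenmotsuAlgebra hβ).K p

theorem reducedCurvature_apply (p : M) (X Y Z : SmoothField I M) :
    reducedCurvature hβ p (X p) (Y p) (Z p) = (kenmotsuAlgebra hβ).K X Y Z p :=
  tensorAt_apply _ p X Y Z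

theorem isReducedCurvature (p : M) :
    IsReducedCurvature (reducedCurvature hβ p) (S.f p).toLinearMap where
  swap x y z := by
    obtain ⟨X, rfl⟩ := exists_smoothField_eq p x
    obtain ⟨Y, rfl⟩ := exists_smoothField_eq p y
    obtain ⟨Z, rfl⟩ := exists_smoothField_eq p z
    rw [reducedCurvature_apply, reducedCurvature_apply, (kenmotsuAlgebra hβ).K_swap]
    rfl
  skew x y z w := by
    obtain ⟨X, rfl⟩ := exists_smoothField_eq p x
    obtain ⟨Y, rfl⟩ := exists_smoothField_eq p y
    obtain ⟨Z, rfl⟩ := exists_smoothField_eq p z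
    obtain ⟨W, rfl⟩ := exists_smoothField_eq p w
    rw [reducedCurvature_apply, reducedCurvature_apply]
    exact congrArg (fun a : SmoothFun I M ↦ a p) ((kenmotsuAlgebra hβ).g_K_skew X Y Z W)
  bianchi x y z := by
    obtain ⟨X, rfl⟩ := exists_smoothField_eq p x
    obtain ⟨Y, rfl⟩ := exists_smoothField_eq p y
    obtain ⟨Z, rfl⟩ := exists_smoothField_eq p z
    rw [reducedCurvature_apply, reducedCurvature_apply, reducedCurvature_apply]
    exact congrArg (fun a : SmoothField I M ↦ a p) ((kenmotsuAlgebra hβ).K_bianchi X Y Z)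
  f_skew x y := S.f_skew p x y
  comm x y z := by
    obtain ⟨X, rfl⟩ := exists_smoothField_eq p x
    obtain ⟨Y, rfl⟩ := exists_smoothField_eq p y
    obtain ⟨Z, rfl⟩ := exists_smoothField_eq p z
    rw [reducedCurvature_apply]
    exact (reducedCurvature_apply hβ p X Y (S.fieldF Z)).trans
      (congrArg (fun a : SmoothField I M ↦ a p) ((kenmotsuAlgebra hβ).K_f X Y Z))

theorem reducedCurvature_ξ_right (p : M) (u v : TangentSpace I p) :
    reducedCurvature hβ p u v (S.ξ p) = 0 := by
  obtain ⟨X, rfl⟩ := exists_smoothField_eq p u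
  obtain ⟨Y, rfl⟩ := exists_smoothField_eq p v
  exact (reducedCurvature_apply hβ p X Y S.fieldξ).trans
    (congrArg (fun a : SmoothField I M ↦ a p) ((kenmotsuAlgebra hβ).K_ξ_right X Y))

theorem curvatureAt_eq_reducedCurvature_sub (p : M) (u v w : TangentSpace I p) :
    curvatureAt I p u v w =
      reducedCurvature hβ p u v w - β ^ 2 • ((inner ℝ v w : ℝ) • u - (inner ℝ u w : ℝ) • v) := by
  obtain ⟨X, rfl⟩ := exists_smoothField_eq p u
  obtain ⟨Y, rfl⟩ := exists_smoothField_eq p v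
  obtain ⟨Z, rfl⟩ := exists_smoothField_eq p w
  rw [curvatureAt_eq, tensorAt_apply, reducedCurvature_apply, eq_sub_iff_add_eq]
  exact (congrArg (fun a : SmoothField I M ↦ a p) ((kenmotsuAlgebra hβ).K_apply X Y Z)).symm

/-- The Ricci contraction of the reduced curvature. -/
noncomputable def ρ (p : M) (u v : TangentSpace I p) : ℝ :=
  ricciContraction (reducedCurvature hβ p) u v

/-- Contraction of `R = K - β² ∧`. -/
theorem ricci_eq (p : M) (u v : TangentSpace I p) :
    ricci I p u v = ρ hβ p u v - (Module.finrank ℝ E - 1) * β ^ 2 * inner ℝ u v := by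
  set b := stdOrthonormalBasis ℝ (TangentSpace I p)
  have h (i) : (inner ℝ (curvatureAt I p (b i) u v) (b i) : ℝ) =
      inner ℝ (reducedCurvature hβ p (b i) u v) (b i)
        - β ^ 2 * (inner ℝ u v - inner ℝ u (b i) * inner ℝ (b i) v) := by
    rw [curvatureAt_eq_reducedCurvature_sub hβ, inner_sub_left, real_inner_smul_left,
      inner_sub_left, real_inner_smul_left, real_inner_smul_left, real_inner_self_eq_norm_sq,
      b.norm_eq_one]
    ring
  rw [ρ, ricciContraction_eq_sum _ b, ricci]
  refine (Finset.sum_congr rfl fun i _ ↦ h i).trans ?_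
  rw [Finset.sum_sub_distrib, ← Finset.mul_sum, Finset.sum_sub_distrib, b.sum_inner_mul_inner,
    Finset.sum_const, Finset.card_univ, Fintype.card_fin, nsmul_eq_mul]
  have hdim : ((Module.finrank ℝ (TangentSpace I p) : ℕ) : ℝ) = Module.finrank ℝ E := rfl
  linear_combination -(β ^ 2 * inner ℝ u v) * hdim

/-- The `∗`-Ricci tensor in terms of the Ricci contraction of the reduced curvature. -/
theorem starRicci_eq (p : M) (u v : TangentSpace I p) :
    S.starRicci p u v =
      -ρ hβ p u (S.f p (S.f p v)) - β ^ 2 * inner ℝ (S.f p u) (S.f p v) := by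
  set b := stdOrthonormalBasis ℝ (TangentSpace I p)
  have h (i) : (inner ℝ (curvatureAt I p u (S.f p v) (S.f p (b i))) (b i) : ℝ) =
      inner ℝ (reducedCurvature hβ p u (S.f p v) (S.f p (b i))) (b i)
        + β ^ 2 * (inner ℝ (S.f p (S.f p v)) (b i) * inner ℝ (b i) u
          - inner ℝ (S.f p u) (b i) * inner ℝ (b i) (S.f p v)) := by
    rw [curvatureAt_eq_reducedCurvature_sub hβ, inner_sub_left, real_inner_smul_left,
      inner_sub_left, real_inner_smul_left, real_inner_smul_left, S.f_skew p (S.f p v) (b i),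
      S.f_skew p u (b i), real_inner_comm u (b i), real_inner_comm (S.f p v) (b i)]
    ring
  have h2 := (isReducedCurvature hβ p).sum_inner_map_map b u v
  rw [starRicci]
  refine (congrArg (fun x : ℝ ↦ 1 / 2 * x) (Finset.sum_congr rfl fun i _ ↦ h i)).trans ?_
  rw [Finset.sum_add_distrib, ← Finset.mul_sum, Finset.sum_sub_distrib, b.sum_inner_mul_inner,
    b.sum_inner_mul_inner, S.f_skew p (S.f p v) u, real_inner_comm (S.f p u) (S.f p v)]
  have h2' : ∑ i, (inner ℝ (reducedCurvature hβ p u (S.f p v) (S.f p (b i))) (b i) : ℝ) =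
    -2 * ρ hβ p u (S.f p (S.f p v)) := h2
  rw [h2']
  ring

omit [FiniteDimensional ℝ E] [IsManifold I ∞ M] [T2Space M]
  [RiemannianBundle (fun p : M ↦ TangentSpace I p)]
  [IsContMDiffRiemannianBundle I ∞ E (fun p : M ↦ TangentSpace I p)] in
theorem mvfderiv_congr {h h' : M → ℝ} {p : M} (hh : h =ᶠ[𝓝 p] h') (v : TangentSpace I p) :
    mvfderiv I h p v = mvfderiv I h' p v := by
  have h1 : mfderiv I 𝓘(ℝ) h p = mfderiv I 𝓘(ℝ) h' p := hh.mfderiv_eq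
  exact congrArg (fun A : TangentSpace I p →L[ℝ] ℝ ↦ A v) h1

/-- The Ricci contraction of the reduced curvature satisfies `∇_ξ ρ = -2 β ρ`. Here the function
`h` witnesses that `ρ(X, Y)` is smooth. -/
theorem mvfderiv_ρ {X Y : SmoothField I M} {h : SmoothFun I M}
    (hh : ∀ q, ρ hβ q (X q) (Y q) = h q) (p : M) :
    mvfderiv I h p (S.ξ p) = ρ hβ p (leviCivita I M X p (S.ξ p)) (Y p)
      + ρ hβ p (X p) (leviCivita I M Y p (S.ξ p)) - 2 * β * ρ hβ p (X p) (Y p) := by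
  -- the trace is differentiated in an orthonormal frame, whose rotation does not contribute
  obtain ⟨e, he⟩ := exists_orthonormal_frame (I := I) p
  set C := kenmotsuAlgebra hβ with hC
  set F : SmoothFun I M := ∑ i, C.g (C.K (e i) X Y) (e i) with hF
  have eval_sum (a : Fin (Module.finrank ℝ E) → SmoothFun I M) (q : M) :
      (∑ i, a i) q = ∑ i, a i q := map_sum (ContMDiffMap.evalRingHom q) a Finset.univ
  have hFh : ⇑h =ᶠ[𝓝 p] ⇑F := by
    filter_upwards [he] with q hq
    obtain ⟨b, hb⟩ := exists_orthonormalBasis_coe_eq hq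
    rw [← hh, ρ, ricciContraction_eq_sum _ b, hF, eval_sum]
    refine Finset.sum_congr rfl fun i _ ↦ ?_
    rw [hb, reducedCurvature_apply]
    rfl
  have h1 : mvfderiv I h p (S.ξ p) = mvfderiv I F p (S.ξ p) := by
    rw [mvfderiv_congr hFh]
  rw [h1]
  obtain ⟨b, hb⟩ := exists_orthonormalBasis_coe_eq he.self_of_nhds
  have h2 : C.D C.ξ F = ∑ i, (C.g (C.K (C.nab C.ξ (e i)) X Y) (e i)
      + C.g (C.K (e i) X Y) (C.nab C.ξ (e i)) + C.g (C.K (e i) (C.nab C.ξ X) Y) (e i)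
      + C.g (C.K (e i) X (C.nab C.ξ Y)) (e i)
      - (C.β * C.g (C.K (e i) X Y) (e i) + C.β * C.g (C.K (e i) X Y) (e i))) := by
    rw [hF, map_sum]
    refine Finset.sum_congr rfl fun i _ ↦ ?_
    rw [C.metric, C.nab_ξ_K']
    simp only [map_sub, map_add, map_smul, LinearMap.sub_apply, LinearMap.add_apply,
      LinearMap.smul_apply, smul_eq_mul]
    ring
  have h3 := congrArg (fun a : SmoothFun I M ↦ a p) h2
  have h4 : mvfderiv I F p (S.ξ p) = ∑ i,
      ((inner ℝ (reducedCurvature hβ p (leviCivita I M (e i) p (S.ξ p)) (X p) (Y p)) (b i) +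
      inner ℝ (reducedCurvature hβ p (b i) (X p) (Y p)) (leviCivita I M (e i) p (S.ξ p))) +
      inner ℝ (reducedCurvature hβ p (b i) (leviCivita I M X p (S.ξ p)) (Y p)) (b i) +
      inner ℝ (reducedCurvature hβ p (b i) (X p) (leviCivita I M Y p (S.ξ p))) (b i) -
      (β * inner ℝ (reducedCurvature hβ p (b i) (X p) (Y p)) (b i)
        + β * inner ℝ (reducedCurvature hβ p (b i) (X p) (Y p)) (b i))) := by
    refine (h3.trans (eval_sum _ p)).trans (Finset.sum_congr rfl fun i _ ↦ ?_)
    rw [hb]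
    have t1 := reducedCurvature_apply hβ p (C.nab C.ξ (e i)) X Y
    have t2 := reducedCurvature_apply hβ p (e i) X Y
    have t3 := reducedCurvature_apply hβ p (e i) (C.nab C.ξ X) Y
    have t4 := reducedCurvature_apply hβ p (e i) X (C.nab C.ξ Y)
    change _ = (inner ℝ (reducedCurvature hβ p (C.nab C.ξ (e i) p) (X p) (Y p)) (e i p) +
      inner ℝ (reducedCurvature hβ p (e i p) (X p) (Y p)) (C.nab C.ξ (e i) p)) +
      inner ℝ (reducedCurvature hβ p (e i p) (C.nab C.ξ X p) (Y p)) (e i p) +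
      inner ℝ (reducedCurvature hβ p (e i p) (X p) (C.nab C.ξ Y p)) (e i p) -
      (β * inner ℝ (reducedCurvature hβ p (e i p) (X p) (Y p)) (e i p)
        + β * inner ℝ (reducedCurvature hβ p (e i p) (X p) (Y p)) (e i p))
    rw [t1, t2, t3, t4]
    rfl
  have hskew (i j) : (inner ℝ (leviCivita I M (e i) p (S.ξ p)) (b j) : ℝ)
      + inner ℝ (b i) (leviCivita I M (e j) p (S.ξ p)) = 0 := by
    have hc : (fun q ↦ (inner ℝ (e i q) (e j q) : ℝ)) =ᶠ[𝓝 p] fun _ ↦ if i = j then 1 else 0 := by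
      filter_upwards [he] with q hq
      obtain ⟨b', hb'⟩ := exists_orthonormalBasis_coe_eq hq
      have hij := b'.inner_eq_ite i j
      rw [hb'] at hij
      exact hij
    have hm := leviCivita_metric I (S.fieldξ (M := M)).mdifferentiableAt
      (e i).mdifferentiableAt (e j).mdifferentiableAt (p := p)
    rw [mvfderiv_congr hc, mvfderiv_const] at hm
    rw [hb]
    exact hm.symm
  have h5 := sum_inner_add_inner_eq_zero_of_skew b _ hskew
    (((reducedCurvature hβ p).flip (X p)).flip (Y p))
  rw [h4, Finset.sum_sub_distrib, Finset.sum_add_distrib, Finset.sum_add_distrib,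
    Finset.sum_add_distrib (f := fun i ↦ β * _), ← Finset.mul_sum]
  rw [ρ, ρ, ρ, ricciContraction_eq_sum _ b, ricciContraction_eq_sum _ b,
    ricciContraction_eq_sum _ b]
  have h5' : ∑ i, (inner ℝ (reducedCurvature hβ p (leviCivita I M (e i) p (S.ξ p)) (X p) (Y p))
      (b i) + inner ℝ (reducedCurvature hβ p (b i) (X p) (Y p))
        (leviCivita I M (e i) p (S.ξ p)) : ℝ) = 0 := h5
  rw [h5', zero_add]
  ring

end ReducedCurvature
end WeakAlmostContactMetric

/-! ### Differentiating the soliton tensor along the Reeb field -/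

namespace KenmotsuAlgebra

variable {A Γ : Type*} [CommRing A] [Algebra ℝ A] [AddCommGroup Γ] [Module A Γ]
  (C : KenmotsuAlgebra A Γ)

/-- The tensor `-(β² g(f X, f Y) + σ (g - η ⊗ η)(X, Y))`. -/
def solitonTensor (σ : A) (X Y : Γ) : A :=
  -(C.β * C.β * C.g (C.f X) (C.f Y) + σ * C.gD X Y)

variable {C} {σ κ : A} (hσ : C.D C.ξ σ = -(C.β * κ))
  (hH : ∀ X Y, C.D C.ξ (C.solitonTensor σ X Y) = C.solitonTensor σ (C.nab C.ξ X) Y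
    + C.solitonTensor σ X (C.nab C.ξ Y) - 2 * C.β * C.solitonTensor σ X Y)
include hσ hH

/-- Comparison of the two expressions for the `ξ`-derivative of the soliton tensor. -/
theorem mul_gD_eq (X Y : Γ) :
    C.β * κ * C.gD X Y = -(2 * C.β * C.solitonTensor σ X Y) := by
  have h := hH X Y
  simp only [solitonTensor, map_neg, map_add, C.D_mul, C.D_β, hσ, C.D_ξ_gD, C.D_ξ_g_f_f] at h ⊢
  linear_combination h

/-- One more `ξ`-derivative of the previous equation. -/
theorem mul_gD_eq_zero (hκ : C.D C.ξ κ = 0) (X Y : Γ) : 2 * C.β * C.β * κ * C.gD X Y = 0 := by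
  have h0 : (2 : A) = 1 + 1 := one_add_one_eq_two.symm
  have hone : C.D C.ξ (1 : A) = 0 := by
    have := C.D_mul C.ξ 1 1
    rw [one_mul, one_mul] at this
    simpa using this
  have h2 : C.D C.ξ (2 : A) = 0 := by rw [h0, map_add, hone, add_zero]
  have h1 := congrArg (C.D C.ξ) (mul_gD_eq hσ hH X Y)
  have h3 := mul_gD_eq hσ hH (C.nab C.ξ X) Y
  have h4 := mul_gD_eq hσ hH X (C.nab C.ξ Y)
  have h5 := mul_gD_eq hσ hH X Y
  rw [map_neg, C.D_mul, C.D_mul, C.D_mul, C.D_mul, hH, C.D_ξ_gD, C.D_β, hκ, h2] at h1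
  linear_combination h1 - h3 - h4 + 2 * C.β * h5

end KenmotsuAlgebra

/-! ### Functions with zero differential -/

/-- A function with zero differential on a connected manifold is constant. -/
theorem exists_eq_const_of_mvfderiv_eq_zero {E : Type*} [NormedAddCommGroup E] [NormedSpace ℝ E]
    {H : Type*} [TopologicalSpace H] {I : ModelWithCorners ℝ E H} [I.Boundaryless]
    {M : Type*} [TopologicalSpace M] [ChartedSpace H M] [IsManifold I ∞ M] [ConnectedSpace M]
    {δ : M → ℝ} (hδ : ContMDiff I 𝓘(ℝ) ∞ δ)
    (h0 : ∀ (p : M) (v : TangentSpace I p), mvfderiv I δ p v = 0) : ∃ c : ℝ, ∀ p, δ p = c := by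
  have : IsManifold I 1 M := IsManifold.of_le (n := ∞) (by decide)
  have hloc : IsLocallyConstant δ := by
    refine (IsLocallyConstant.iff_eventually_eq δ).2 fun p ↦ ?_
    obtain ⟨r, hr, hb⟩ := Metric.isOpen_iff.1 (isOpen_extChartAt_target (I := I) p) _
      (mem_extChartAt_target (I := I) p)
    have hd (y : E) (hy : y ∈ Metric.ball (extChartAt I p p) r) :
        HasFDerivAt (δ ∘ (extChartAt I p).symm) (0 : E →L[ℝ] ℝ) y := by
      have h1 : MDifferentiableAt 𝓘(ℝ, E) I (extChartAt I p).symm y :=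
        ((contMDiffOn_extChartAt_symm (n := ∞) p).contMDiffAt
          ((isOpen_extChartAt_target p).mem_nhds (hb hy))).mdifferentiableAt (by simp)
      have h2 : MDifferentiableAt I 𝓘(ℝ) δ ((extChartAt I p).symm y) :=
        hδ.mdifferentiableAt (by simp)
      have h3 := mfderiv_comp y h2 h1
      have h4 : mfderiv I 𝓘(ℝ) δ ((extChartAt I p).symm y) = 0 :=
        ContinuousLinearMap.ext fun v ↦ h0 _ v
      rw [h4, ContinuousLinearMap.zero_comp, mfderiv_eq_fderiv] at h3
      have h5 : DifferentiableAt ℝ (δ ∘ (extChartAt I p).symm) y :=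
        mdifferentiableAt_iff_differentiableAt.1 (h2.comp y h1)
      have h6 := h5.hasFDerivAt
      rwa [h3] at h6
    have hU : extChartAt I p ⁻¹' Metric.ball (extChartAt I p p) r ∈ 𝓝 p :=
      (continuousAt_extChartAt (I := I) p).preimage_mem_nhds (Metric.ball_mem_nhds _ hr)
    filter_upwards [hU, extChartAt_source_mem_nhds (I := I) p] with q hq hqs
    have h6 := (convex_ball (extChartAt I p p) r).is_const_of_fderivWithin_eq_zero
      (𝕜 := ℝ) (f := δ ∘ (extChartAt I p).symm)
      (fun y hy ↦ (hd y hy).differentiableAt.differentiableWithinAt)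
      (fun y hy ↦ by
        rw [fderivWithin_of_isOpen Metric.isOpen_ball hy, (hd y hy).fderiv]) hq
      (Metric.mem_ball_self hr)
    rwa [Function.comp_apply, Function.comp_apply, (extChartAt I p).left_inv hqs,
      extChartAt_to_inv] at h6
  obtain ⟨p⟩ : Nonempty M := inferInstance
  exact ⟨δ p, fun q ↦ hloc.apply_eq_of_isPreconnected isPreconnected_univ trivial trivial⟩

/-! ### Solitons along the Reeb field -/

namespace WeakAlmostContactMetric

section Soliton

variable {E : Type*} [NormedAddCommGroup E] [NormedSpace ℝ E] [FiniteDimensional ℝ E]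
  {H : Type*} [TopologicalSpace H] {I : ModelWithCorners ℝ E H}
  {M : Type*} [TopologicalSpace M] [ChartedSpace H M] [IsManifold I ∞ M] [T2Space M]
  [RiemannianBundle (fun p : M ↦ TangentSpace I p)]
  [IsContMDiffRiemannianBundle I ∞ E (fun p : M ↦ TangentSpace I p)] {n : ℕ}
  {S : WeakAlmostContactMetric I M n} {β : ℝ} (hβ : S.IsWeakKenmotsu fun _ ↦ β)

theorem ρ_ξ_right (p : M) (u : TangentSpace I p) : ρ hβ p u (S.ξ p) = 0 := by
  rw [ρ, ricciContraction_eq_sum _ (stdOrthonormalBasis ℝ (TangentSpace I p))]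
  exact Finset.sum_eq_zero fun i _ ↦ by rw [reducedCurvature_ξ_right, inner_zero_left]

include hβ in
theorem starRicci_ξ_right (p : M) (u : TangentSpace I p) : S.starRicci p u (S.ξ p) = 0 := by
  rw [starRicci_eq hβ, S.f_ξ, map_zero, inner_zero_right, mul_zero, sub_zero, ρ,
    ricciContraction, map_zero, map_zero, neg_zero]

variable {δ : SmoothFun I M} {lam mu : ℝ}

include hβ in
theorem lieDerivMetric_smul_ξ (δ : SmoothFun I M) (X Y : SmoothField I M) (p : M) :
    lieDerivMetric I (fun p ↦ δ p • S.ξ p) X Y p =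
      mvfderiv I δ p (X p) * S.η p (Y p) + mvfderiv I δ p (Y p) * S.η p (X p)
        + 2 * (δ p * β) * (inner ℝ (X p) (Y p) - S.η p (X p) * S.η p (Y p)) := by
  have h2 : (2 : SmoothFun I M) p = 2 := map_ofNat (ContMDiffMap.evalRingHom p) 2
  have h := congrArg (fun a : SmoothFun I M ↦ a p) ((kenmotsuAlgebra hβ).lie_smul_ξ δ X Y)
  refine h.trans ?_
  rw [← h2, ← S.inner_ξ p (X p), ← S.inner_ξ p (Y p)]
  rfl

variable (hS : S.IsStarEtaRicciSoliton (fun p ↦ δ p • S.ξ p) lam mu)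
include hβ hS

theorem soliton_eq (p : M) (u v : TangentSpace I p) :
    1 / 2 * (mvfderiv I δ p u * S.η p v + mvfderiv I δ p v * S.η p u)
      + δ p * β * (inner ℝ u v - S.η p u * S.η p v) + S.starRicci p u v =
        lam * inner ℝ u v + mu * (S.η p u * S.η p v) := by
  obtain ⟨X, rfl⟩ := exists_smoothField_eq p u
  obtain ⟨Y, rfl⟩ := exists_smoothField_eq p v
  rw [← hS.2 X Y X.contMDiff Y.contMDiff p, lieDerivMetric_smul_ξ hβ]
  ring

/-- The soliton equation contracted with `ξ`, which is in the kernel of the `∗`-Ricci tensor: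
`dδ = (lam + mu) η`. -/
theorem mvfderiv_potential (p : M) (u : TangentSpace I p) :
    mvfderiv I δ p u = (lam + mu) * S.η p u := by
  have h (u : TangentSpace I p) := soliton_eq hβ hS p u (S.ξ p)
  simp only [starRicci_ξ_right hβ, S.inner_ξ, S.η_ξ] at h
  have h1 := h (S.ξ p)
  rw [S.η_ξ] at h1
  linear_combination 2 * h u - S.η p u * h1

/-- The `∗`-Ricci tensor of a soliton is `(lam - δ β) (g - η ⊗ η)`. -/
theorem starRicci_eq_of_soliton (p : M) (u v : TangentSpace I p) :
    S.starRicci p u v = (lam - δ p * β) * (inner ℝ u v - S.η p u * S.η p v) := by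
  have h := soliton_eq hβ hS p u v
  rw [mvfderiv_potential hβ hS, mvfderiv_potential hβ hS] at h
  linear_combination h

theorem ρ_f_f (p : M) (u v : TangentSpace I p) :
    ρ hβ p u (S.f p (S.f p v)) = -(β * β * inner ℝ (S.f p u) (S.f p v)
      + (lam - δ p * β) * (inner ℝ u v - S.η p u * S.η p v)) := by
  have h := starRicci_eq hβ p u v
  rw [starRicci_eq_of_soliton hβ hS] at h
  linear_combination h

/-- The function `lam - δ β`, by which the `∗`-Ricci tensor of a soliton is proportional to
`g - η ⊗ η`. -/
noncomputable def solitonFun (β lam : ℝ) (δ : SmoothFun I M) : SmoothFun I M :=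
  algebraMap ℝ _ lam - δ * algebraMap ℝ _ β

theorem ρ_eq_solitonTensor (X Y : SmoothField I M) (p : M) :
    ρ hβ p (X p) (S.f p (S.f p (Y p))) =
      (kenmotsuAlgebra hβ).solitonTensor (solitonFun β lam δ) X Y p := by
  rw [ρ_f_f hβ hS, ← S.inner_ξ, ← S.inner_ξ]
  rfl

theorem D_ξ_solitonFun :
    (kenmotsuAlgebra hβ).D (kenmotsuAlgebra hβ).ξ (solitonFun β lam δ) =
      -((kenmotsuAlgebra hβ).β * algebraMap ℝ _ (lam + mu)) := by
  have hconst (c : ℝ) :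
      (kenmotsuAlgebra hβ).D (kenmotsuAlgebra hβ).ξ (algebraMap ℝ (SmoothFun I M) c) = 0 := by
    ext q
    exact congrArg (fun A : TangentSpace I q →L[ℝ] ℝ ↦ A (S.ξ q)) (mvfderiv_const c)
  have hD : (kenmotsuAlgebra hβ).D (kenmotsuAlgebra hβ).ξ δ =
      algebraMap ℝ _ (lam + mu) := by
    ext q
    refine (mvfderiv_potential hβ hS q (S.ξ q)).trans ?_
    rw [S.η_ξ, mul_one]
    rfl
  rw [solitonFun, map_sub, hconst, (kenmotsuAlgebra hβ).D_mul, hconst, hD]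
  change _ = -(algebraMap ℝ (SmoothFun I M) β * algebraMap ℝ _ (lam + mu))
  ring

/-- The rule `∇_ξ ρ = -2 β ρ`, read on the soliton tensor `ρ(X, f² Y)`. -/
theorem D_ξ_solitonTensor (X Y : SmoothField I M) :
    (kenmotsuAlgebra hβ).D (kenmotsuAlgebra hβ).ξ
        ((kenmotsuAlgebra hβ).solitonTensor (solitonFun β lam δ) X Y) =
      (kenmotsuAlgebra hβ).solitonTensor (solitonFun β lam δ)
          ((kenmotsuAlgebra hβ).nab (kenmotsuAlgebra hβ).ξ X) Y
        + (kenmotsuAlgebra hβ).solitonTensor (solitonFun β lam δ) X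
          ((kenmotsuAlgebra hβ).nab (kenmotsuAlgebra hβ).ξ Y)
        - 2 * (kenmotsuAlgebra hβ).β *
          (kenmotsuAlgebra hβ).solitonTensor (solitonFun β lam δ) X Y := by
  ext p
  have h2 : (2 : SmoothFun I M) p = 2 := map_ofNat (ContMDiffMap.evalRingHom p) 2
  have h := mvfderiv_ρ hβ (X := X) (Y := S.fieldF (S.fieldF Y))
    (fun q ↦ ρ_eq_solitonTensor hβ hS X Y q) p
  refine h.trans ?_
  have h3 : leviCivita I M (S.fieldF (S.fieldF Y)) p (S.ξ p) =
      S.f p (S.f p (leviCivita I M Y p (S.ξ p))) := by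
    have h4 : (kenmotsuAlgebra hβ).nab (kenmotsuAlgebra hβ).ξ
        ((kenmotsuAlgebra hβ).f ((kenmotsuAlgebra hβ).f Y)) =
        (kenmotsuAlgebra hβ).f ((kenmotsuAlgebra hβ).f
          ((kenmotsuAlgebra hβ).nab (kenmotsuAlgebra hβ).ξ Y)) := by
      rw [KenmotsuAlgebra.nab_ξ_f, KenmotsuAlgebra.nab_ξ_f]
    exact congrArg (fun a : SmoothField I M ↦ a p) h4
  rw [h3]
  refine (congrArg₂ (· - ·) (congrArg₂ (· + ·)
    (ρ_eq_solitonTensor hβ hS ((kenmotsuAlgebra hβ).nab (kenmotsuAlgebra hβ).ξ X) Y p)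
    (ρ_eq_solitonTensor hβ hS X ((kenmotsuAlgebra hβ).nab (kenmotsuAlgebra hβ).ξ Y) p))
    (congrArg (2 * β * ·) (ρ_eq_solitonTensor hβ hS X Y p))).trans ?_
  rw [← h2]
  rfl

omit [FiniteDimensional ℝ E] [T2Space M]
  [IsContMDiffRiemannianBundle I ∞ E fun p : M ↦ TangentSpace I p] hβ hS in
theorem exists_η_eq_zero_ne_zero (hn : 1 ≤ n) (p : M) :
    ∃ w : TangentSpace I p, S.η p w = 0 ∧ w ≠ 0 := by
  have h : LinearMap.range (S.f p).toLinearMap ≠ ⊥ := fun h ↦ by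
    have h1 := S.rank_f p
    rw [h, finrank_bot] at h1
    omega
  obtain ⟨w, ⟨v, rfl⟩, hw⟩ := Submodule.exists_mem_ne_zero_of_ne_bot h
  exact ⟨S.f p v, S.η_f_apply p v, hw⟩

/-- The soliton constants satisfy `lam + mu = 0`. -/
theorem lam_add_mu_eq_zero (hn : 1 ≤ n) [Nonempty M] : lam + mu = 0 := by
  obtain ⟨p⟩ : Nonempty M := inferInstance
  obtain ⟨w, hw, hw0⟩ := exists_η_eq_zero_ne_zero (S := S) hn p
  obtain ⟨X, rfl⟩ := exists_smoothField_eq p w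
  have hκ : (kenmotsuAlgebra hβ).D (kenmotsuAlgebra hβ).ξ
      (algebraMap ℝ (SmoothFun I M) (lam + mu)) = 0 := by
    ext q
    exact congrArg (fun A : TangentSpace I q →L[ℝ] ℝ ↦ A (S.ξ q)) (mvfderiv_const (lam + mu))
  have h := congrArg (fun a : SmoothFun I M ↦ a p) (KenmotsuAlgebra.mul_gD_eq_zero
    (D_ξ_solitonFun hβ hS) (D_ξ_solitonTensor hβ hS) hκ X X)
  have h2 : (2 : SmoothFun I M) p = 2 := map_ofNat (ContMDiffMap.evalRingHom p) 2
  change (2 : SmoothFun I M) p * β * β * (lam + mu) *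
    (inner ℝ (X p) (X p) - inner ℝ (X p) (S.ξ p) * inner ℝ (X p) (S.ξ p)) = 0 at h
  rw [h2, S.inner_ξ, hw, mul_zero, sub_zero] at h
  have hb : β ≠ 0 := hβ.ne_zero p
  simpa [hb, hw0] using h

/-- As `lam + mu = 0`, the soliton tensor `ρ(u, f² v)` vanishes. The vectors `f² v` and `ξ` span the
range of `Q`, which is everything. -/
theorem ρ_eq_zero_of_soliton (hn : 1 ≤ n) (p : M) (u v : TangentSpace I p) : ρ hβ p u v = 0 := by
  have : Nonempty M := ⟨p⟩
  have hκ := lam_add_mu_eq_zero hβ hS hn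
  have hff (v : TangentSpace I p) : ρ hβ p u (S.f p (S.f p v)) = 0 := by
    obtain ⟨X, rfl⟩ := exists_smoothField_eq p u
    obtain ⟨Y, rfl⟩ := exists_smoothField_eq p v
    rw [ρ_eq_solitonTensor hβ hS]
    have h := congrArg (fun a : SmoothFun I M ↦ a p) (KenmotsuAlgebra.mul_gD_eq
      (D_ξ_solitonFun hβ hS) (D_ξ_solitonTensor hβ hS) X Y)
    have h2 : (2 : SmoothFun I M) p = 2 := map_ofNat (ContMDiffMap.evalRingHom p) 2
    change β * (lam + mu) * (kenmotsuAlgebra hβ).gD X Y p = -((2 : SmoothFun I M) p * β *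
      (kenmotsuAlgebra hβ).solitonTensor (solitonFun β lam δ) X Y p) at h
    rw [h2, hκ] at h
    have hb : β ≠ 0 := hβ.ne_zero p
    simpa [hb] using h
  obtain ⟨w, rfl⟩ := (S.bijective_Q p).2 v
  have h1 := hff w
  have h2 := ρ_ξ_right hβ p u
  rw [ρ, ricciContraction] at h1 h2 ⊢
  rw [S.Q_eq, map_add, map_neg, map_smul, map_add, map_neg, map_smul, h1, h2]
  simp

theorem ricci_eq_of_soliton (hn : 1 ≤ n) (p : M) (u v : TangentSpace I p) :
    ricci I p u v = -(Module.finrank ℝ E - 1) * β ^ 2 * inner ℝ u v := by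
  rw [ricci_eq hβ, ρ_eq_zero_of_soliton hβ hS hn]
  ring

end Soliton
end WeakAlmostContactMetric

end WeakKenmotsu

theorem theorem4 (n : ℕ) (hn : 1 ≤ n)
    {M : Type*} [TopologicalSpace M] [T2Space M] [SecondCountableTopology M] [ConnectedSpace M]
    [ChartedSpace (EuclideanSpace ℝ (Fin (2 * n + 1))) M] [IsManifold (𝓡 (2 * n + 1)) ∞ M]
    [RiemannianBundle (fun p : M ↦ TangentSpace (𝓡 (2 * n + 1)) p)]
    [IsContMDiffRiemannianBundle (𝓡 (2 * n + 1)) ∞ (EuclideanSpace ℝ (Fin (2 * n + 1)))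
      (fun p : M ↦ TangentSpace (𝓡 (2 * n + 1)) p)]
    (S : WeakKenmotsu.WeakAlmostContactMetric (𝓡 (2 * n + 1)) M n)
    (β : ℝ) (hβ : S.IsWeakKenmotsu (fun _ ↦ β))
    (δ : M → ℝ) (hδ : ContMDiff (𝓡 (2 * n + 1)) 𝓘(ℝ) ∞ δ) (hδ0 : δ ≠ 0)
    (lam mu : ℝ) (hS : S.IsStarEtaRicciSoliton (fun p ↦ δ p • S.ξ p) lam mu) :
    (∃ c : ℝ, ∀ p, δ p = c) ∧
      WeakKenmotsu.IsEinstein (𝓡 (2 * n + 1)) M ∧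
      (∀ p : M, WeakKenmotsu.scalarCurvature (𝓡 (2 * n + 1)) p =
        -2 * (n : ℝ) * (2 * n + 1) * β ^ 2) ∧
      S.IsStarEtaEinstein := by
  let δ' : WeakKenmotsu.SmoothFun (𝓡 (2 * n + 1)) M := ⟨δ, hδ⟩
  have hS' : S.IsStarEtaRicciSoliton (fun p ↦ δ' p • S.ξ p) lam mu := hS
  have hdim : Module.finrank ℝ (EuclideanSpace ℝ (Fin (2 * n + 1))) = 2 * n + 1 :=
    finrank_euclideanSpace_fin
  have hric (p : M) (u v : TangentSpace (𝓡 (2 * n + 1)) p) :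
      WeakKenmotsu.ricci (𝓡 (2 * n + 1)) p u v = -2 * n * β ^ 2 * inner ℝ u v := by
    rw [WeakKenmotsu.WeakAlmostContactMetric.ricci_eq_of_soliton hβ hS' hn, hdim]
    push_cast
    ring
  refine ⟨?_, ⟨-2 * n * β ^ 2, hric⟩, fun p ↦ ?_, ?_⟩
  · refine WeakKenmotsu.exists_eq_const_of_mvfderiv_eq_zero hδ fun p v ↦ ?_
    have h := WeakKenmotsu.WeakAlmostContactMetric.mvfderiv_potential hβ hS' p v
    rwa [WeakKenmotsu.WeakAlmostContactMetric.lam_add_mu_eq_zero hβ hS' hn, zero_mul] at h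
  · have hdim' : Module.finrank ℝ (TangentSpace (𝓡 (2 * n + 1)) p) = 2 * n + 1 := hdim
    have h (i) : WeakKenmotsu.ricci (𝓡 (2 * n + 1)) p
        (stdOrthonormalBasis ℝ (TangentSpace (𝓡 (2 * n + 1)) p) i)
        (stdOrthonormalBasis ℝ (TangentSpace (𝓡 (2 * n + 1)) p) i) = -2 * n * β ^ 2 := by
      rw [hric, real_inner_self_eq_norm_sq, OrthonormalBasis.norm_eq_one]
      ring
    refine (Finset.sum_congr rfl fun i _ ↦ h i).trans ?_
    rw [Finset.sum_const, Finset.card_univ, Fintype.card_fin, nsmul_eq_mul]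
    have hdimR : ((Module.finrank ℝ (TangentSpace (𝓡 (2 * n + 1)) p) : ℕ) : ℝ) = 2 * n + 1 := by
      exact_mod_cast hdim'
    linear_combination (-2 * n * β ^ 2) * hdimR
  · have ha : ContMDiff (𝓡 (2 * n + 1)) 𝓘(ℝ) ∞ fun p ↦ lam - δ p * β :=
      contMDiff_const.sub (hδ.mul contMDiff_const)
    refine ⟨_, _, ha, ha.neg, fun p u v ↦ ?_⟩
    rw [WeakKenmotsu.WeakAlmostContactMetric.starRicci_eq_of_soliton hβ hS']
    change (lam - δ p * β) * _ = (lam - δ p * β) * _ + -(lam - δ p * β) * _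
    ring
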